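/- For $\theta\in\mathbb{T}_{2\pi}=\mathbb{R}/2\pi\mathbb{Z}$ let $\mathbf{u}(\theta)=(\cos\theta,\sin\theta)$ and let $\sigma_\theta$ be the counterclockwise rotation of $\mathbb{R}^2$ by $\theta$. For $\delta\ge 0$ and a bounded set $\Omega\subset\mathbb{R}^2$ put $[\delta,\theta]\Omega=\delta\,\sigma_\theta\Omega$ and $\widehat{\mathbb 1}_\Omega(\boldsymbol\xi)=\int_\Omega e^{-2\pi i\,\mathbf{x}\cdot\boldsymbol\xi}\,d\mathbf{x}$. A planar convex body is a bounded convex set $C\subset\mathbb{R}^2$ with non-empty interior. For $\mathbf{p}\in\partial C$ let $$\nu_C(\mathbf{p})=\Big\{\theta\in\mathbb{T}_{2\pi}\,:\,\min_{\mathbf{a}\in\overline{C}}\mathbf{a}\cdot\mathbf{u}(\theta)=\mathbf{p}\cdot\mathbf{u}(\theta)\Big\},\qquad \mathcal{T}_C=\bigcup_{\mathbf{p}\in\partial C}\mathrm{int}\,\nu_C(\mathbf{p}),$$ where $\mathrm{int}$ denotes the interior in $\mathbb{T}_{2\pi}$. Let $\psi_C$ be the maximal length of a connected component of $\mathcal{T}_C\cap(\mathcal{T}_C+\pi)$,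 with $\psi_C=0$ if this set is empty. Lemma. Let $C\subset\mathbb{R}^2$ be a planar convex body and let $I\subseteq\mathbb{T}_{2\pi}$ be an interval of angles (the image of an interval of $\mathbb{R}$, of any kind) whose length $|I|$ satisfies $\psi_C<|I|\le 2\pi$. Then there are constants $c_1,c_2,\rho_0>0$, depending only on $C$ and $I$, such that for every $\omega\in\mathbb{T}_{2\pi}$ and every $\rho\ge\rho_0$, $$c_1\,\rho^{-3}\;\le\;\int_I\int_0^1\left|\widehat{\mathbb 1}_{[\delta,\theta]C}(\rho\,\mathbf{u}(\omega))\right|^2\,d\delta\,d\theta\;\le\; c_2\,\rho^{-3}.$$ -/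

import Mathlib

open MeasureTheory
open scoped Real FourierTransform ENNReal

noncomputable section

/-- The Euclidean plane. -/
abbrev Plane : Type := EuclideanSpace ℝ (Fin 2)

instance factTwoPiPos : Fact (0 < 2 * π) := ⟨Real.two_pi_pos⟩

/-- The circle of angles `ℝ / 2πℤ`; its `volume` is arc length, of total mass `2π`. -/
abbrev AngleCircle : Type := AddCircle (2 * π)

/-- Cosine of an angle. -/
def angleCos (θ : AngleCircle) : ℝ := Real.cos_periodic.lift θ

/-- Sine of an angle. -/
def angleSin (θ : AngleCircle) : ℝ := Real.sin_periodic.lift θ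

/-- The unit vector `u(θ) = (cos θ, sin θ)`. -/
def unitVec (θ : AngleCircle) : Plane := !₂[angleCos θ, angleSin θ]

/-- The counterclockwise rotation of the plane by the angle `θ`. -/
def rotate (θ : AngleCircle) (x : Plane) : Plane :=
  !₂[angleCos θ * x 0 - angleSin θ * x 1, angleSin θ * x 0 + angleCos θ * x 1]

/-- The set `[δ, θ]Ω`: `Ω` rotated by `θ` and then dilated by `δ`. -/
def dilateRotate (δ : ℝ) (θ : AngleCircle) (Ω : Set Plane) : Set Plane :=
  (fun x => δ • rotate θ x) '' Ω

/-- The Fourier transform of the characteristic function of `Ω`,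
`ξ ↦ ∫_Ω exp(-2πi x·ξ) dx`. -/
def fourierIndicator (Ω : Set Plane) (ξ : Plane) : ℂ :=
  𝓕 (Ω.indicator fun _ => (1 : ℂ)) ξ

/-- A planar convex body: a bounded convex set with non-empty interior
(it need not be closed). -/
structure IsPlanarConvexBody (C : Set Plane) : Prop where
  convex : Convex ℝ C
  bounded : Bornology.IsBounded C
  nonempty_interior : (interior C).Nonempty

/-- The set of normals of `C` at a point `p` of its boundary: the angles `θ` for which the minimum
of `a ↦ a · u(θ)` over `C` equals `p · u(θ)`. As `C` need not be closed, the minimum is taken over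
the closure of `C`, where it is attained; it is the infimum over `C`. -/
def normalAngles (C : Set Plane) (p : Plane) : Set AngleCircle :=
  {θ | IsLeast ((fun a => inner ℝ a (unitVec θ)) '' closure C) (inner ℝ p (unitVec θ))}

/-- The angular trace of `C`: the union, over the points of the boundary of `C`, of the interiors
(in the circle of angles) of the sets of normals. The arc-length parametrization only serves to
list the boundary points, so the union is indexed by the points themselves. -/
def angularTrace (C : Set Plane) : Set AngleCircle :=
  ⋃ p ∈ frontier C, interior (normalAngles C p)

/-- The set `T ∩ (T + π)`, where `T` is the angular trace of `C`. -/
def symmetricTrace (C : Set Plane) : Set AngleCircle :=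
  angularTrace C ∩ (fun θ => θ + ((π : ℝ) : AngleCircle)) '' angularTrace C

/-- The symmetric angular threshold `ψ_C`: the largest length of a connected component of
`T ∩ (T + π)`, and `0` if this set is empty. (The components are disjoint open arcs of total
length at most `2π`, so the supremum is a maximum.) -/
def symmetricAngularThreshold (C : Set Plane) : ℝ≥0∞ :=
  ⨆ θ ∈ symmetricTrace C, volume (connectedComponentIn (symmetricTrace C) θ)

/-- An interval of angles: the image in the circle of an interval of the real line (of any kind:
open, closed, half-open, possibly covering the whole circle). -/
def IsAngleInterval (I : Set AngleCircle) : Prop :=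
  ∃ J : Set ℝ, J.OrdConnected ∧ I = (fun t : ℝ => (t : AngleCircle)) '' J

/-- The average `∫_I ∫_0^1 |F_{δ,θ}(ρ u(ω))|² dδ dθ`, with `F_{δ,θ}` the Fourier transform of the
characteristic function of `[δ, θ]C`. -/
def fourierAverage (C : Set Plane) (I : Set AngleCircle) (ω : AngleCircle) (ρ : ℝ) : ℝ :=
  ∫ θ in I, ∫ δ in (0 : ℝ)..1,
    ‖fourierIndicator (dilateRotate δ θ C) (ρ • unitVec ω)‖ ^ 2

end

/-!
Polar coordinates in `(δ, θ)` turn the average into the integral of `φ ↦ E(ρ, φ)` over the arc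
`ω - I`, where `E(ρ, φ) = ∫₀¹ δ⁴ |F(δρ u(φ))|² dδ` is an energy of the Fourier transform `F` of
the characteristic function of `C` along a ray.

For the upper bound, integrate `E(ρ, ·)` over all directions to get at most
`∫_{|ξ| ≤ 1} |ξ|² |F(ρξ)|² dξ`. Since `|1 - e^{iπt}| ≥ 2|t|` for `|t| ≤ 1`, Plancherel's theorem
bounds this by the `L²` distance of the characteristic function to its translates, which is
controlled because every line meets `C` in a segment.

For the lower bound, let `θ` be a direction outside the angular trace `T`. A minimizer of
`a ↦ a · u(θ)` on the closure of `C` fails to minimize in some directions arbitrarily close to `θ`,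
so `C` has two distinct points of support in nearly the same direction, and between them its
boundary is a graph of slope at most `s` over the line orthogonal to `u(θ)`, with `s` as small as
we like. Testing `F(R ·)` against a bump function `χ` at `u(θ) / 2` amounts to convolving the
characteristic function of `R C` with the inverse transform of `χ`. Along a boundary strip of
length of order `R` the convolution stays close to the integral of that inverse transform over a
half-plane with normal `u(θ)`, and some such half-plane integral is nonzero because
`χ(u(θ) / 2) ≠ 0`. So the energy near `θ` is at least of order `R⁻³`.

As `F(-ξ)` is the conjugate of `F(ξ)`, the function `E(ρ, ·)` is `π`-periodic, so the same holds at
every direction outside `T ∩ (T + π)`. An arc longer than `ψ_C` contains such a direction, and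
compactness of the complement of `T ∩ (T + π)` makes the bound uniform over rotations of the arc.
-/

/-! ### Angles and rotations -/

@[simp] lemma angleCos_zero : angleCos 0 = 1 := Real.cos_zero

@[simp] lemma angleSin_zero : angleSin 0 = 0 := Real.sin_zero

@[simp] lemma angleCos_coe (t : ℝ) : angleCos (t : AngleCircle) = Real.cos t := rfl

@[simp] lemma angleSin_coe (t : ℝ) : angleSin (t : AngleCircle) = Real.sin t := rfl

lemma angleCos_sq_add_angleSin_sq (θ : AngleCircle) : angleCos θ ^ 2 + angleSin θ ^ 2 = 1 :=
  Real.Angle.cos_sq_add_sin_sq θ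

lemma angleCos_add (θ φ : AngleCircle) :
    angleCos (θ + φ) = angleCos θ * angleCos φ - angleSin θ * angleSin φ :=
  Real.Angle.cos_add θ φ

lemma angleSin_add (θ φ : AngleCircle) :
    angleSin (θ + φ) = angleSin θ * angleCos φ + angleCos θ * angleSin φ :=
  Real.Angle.sin_add θ φ

lemma continuous_unitVec : Continuous unitVec := by
  refine (PiLp.continuous_toLp 2 _).comp (continuous_pi fun i => ?_)
  fin_cases i
  exacts [Real.continuous_cos.quotient_lift _, Real.continuous_sin.quotient_lift _]

lemma plane_ext {x y : Plane} (h₀ : x 0 = y 0) (h₁ : x 1 = y 1) : x = y := by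
  ext i; fin_cases i <;> assumption

lemma inner_plane (x y : Plane) : inner ℝ x y = x 0 * y 0 + x 1 * y 1 := by
  simp [PiLp.inner_apply, Fin.sum_univ_two, mul_comm]

lemma norm_sq_plane (x : Plane) : ‖x‖ ^ 2 = x 0 ^ 2 + x 1 ^ 2 := by
  simp [EuclideanSpace.norm_sq_eq, Fin.sum_univ_two]

@[simp] lemma unitVec_apply_zero (θ : AngleCircle) : unitVec θ 0 = angleCos θ := rfl

@[simp] lemma unitVec_apply_one (θ : AngleCircle) : unitVec θ 1 = angleSin θ := rfl

@[simp] lemma rotate_apply_zero (θ : AngleCircle) (x : Plane) :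
    rotate θ x 0 = angleCos θ * x 0 - angleSin θ * x 1 := rfl

@[simp] lemma rotate_apply_one (θ : AngleCircle) (x : Plane) :
    rotate θ x 1 = angleSin θ * x 0 + angleCos θ * x 1 := rfl

@[simp] lemma norm_unitVec (θ : AngleCircle) : ‖unitVec θ‖ = 1 := by
  rw [← sq_eq_sq₀ (norm_nonneg _) zero_le_one, norm_sq_plane, one_pow]
  exact angleCos_sq_add_angleSin_sq θ

lemma norm_smul_unitVec {r : ℝ} (hr : 0 ≤ r) (θ : AngleCircle) : ‖r • unitVec θ‖ = r := by
  rw [norm_smul, norm_unitVec, mul_one, Real.norm_of_nonneg hr]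

lemma unitVec_injective : Function.Injective unitVec := by
  intro θ φ h
  have hcos : angleCos θ = angleCos φ := congrArg (· 0) h
  have hsin : angleSin θ = angleSin φ := congrArg (· 1) h
  induction θ using QuotientAddGroup.induction_on
  induction φ using QuotientAddGroup.induction_on
  exact Real.Angle.cos_sin_inj hcos hsin

lemma unitVec_add_pi (θ : AngleCircle) : unitVec (θ + ((π : ℝ) : AngleCircle)) = -unitVec θ := by
  apply plane_ext <;> simp [angleCos_add, angleSin_add]

lemma rotate_unitVec (θ φ : AngleCircle) : rotate θ (unitVec φ) = unitVec (θ + φ) := by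
  apply plane_ext <;> simp [angleCos_add, angleSin_add]

lemma rotate_rotate (θ φ : AngleCircle) (x : Plane) :
    rotate θ (rotate φ x) = rotate (θ + φ) x := by
  apply plane_ext <;> simp [angleCos_add, angleSin_add] <;> ring

lemma rotate_zero (x : Plane) : rotate 0 x = x := by
  apply plane_ext <;> simp

lemma norm_rotate (θ : AngleCircle) (x : Plane) : ‖rotate θ x‖ = ‖x‖ := by
  rw [← sq_eq_sq₀ (norm_nonneg _) (norm_nonneg _), norm_sq_plane, norm_sq_plane,
    rotate_apply_zero, rotate_apply_one]
  linear_combination (x 0 ^ 2 + x 1 ^ 2) * angleCos_sq_add_angleSin_sq θ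

/-- The rotation by `θ`, as a linear isometry with inverse the rotation by `-θ`. -/
noncomputable def rotateIso (θ : AngleCircle) : Plane ≃ₗᵢ[ℝ] Plane where
  toFun := rotate θ
  invFun := rotate (-θ)
  map_add' x y := by apply plane_ext <;> simp <;> ring
  map_smul' c x := by apply plane_ext <;> simp <;> ring
  left_inv x := by rw [rotate_rotate, neg_add_cancel, rotate_zero]
  right_inv x := by rw [rotate_rotate, add_neg_cancel, rotate_zero]
  norm_map' x := norm_rotate θ x

/-- The plane in the rectangular coordinates whose second axis has the direction `u(θ)`, and
whose first axis has the direction `u(θ - π/2)`. -/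
noncomputable def axisCoords (θ : AngleCircle) : (ℝ × ℝ) ≃L[ℝ] Plane :=
  ((ContinuousLinearEquiv.finTwoArrow ℝ ℝ).symm.trans
    (PiLp.continuousLinearEquiv 2 ℝ fun _ : Fin 2 => ℝ).symm).trans
    (rotateIso (θ - ((π / 2 : ℝ) : AngleCircle))).toContinuousLinearEquiv

lemma axisCoords_apply (θ : AngleCircle) (p : ℝ × ℝ) :
    axisCoords θ p = rotate (θ - ((π / 2 : ℝ) : AngleCircle)) !₂[p.1, p.2] := rfl

lemma measurePreserving_axisCoords (θ : AngleCircle) : MeasurePreserving (axisCoords θ) :=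
  (rotateIso _).measurePreserving.comp
    ((PiLp.volume_preserving_toLp (Fin 2)).comp (volume_preserving_finTwoArrow ℝ).symm)

lemma measurableEmbedding_axisCoords (θ : AngleCircle) : MeasurableEmbedding (axisCoords θ) :=
  (axisCoords θ).toHomeomorph.measurableEmbedding

lemma inner_axisCoords (θ : AngleCircle) (α : ℝ) (p : ℝ × ℝ) :
    inner ℝ (axisCoords θ p) (unitVec (θ + (α : AngleCircle))) =
      p.2 * Real.cos α - p.1 * Real.sin α := by
  have hu : unitVec (θ + (α : AngleCircle)) =
      rotateIso (θ - ((π / 2 : ℝ) : AngleCircle)) (unitVec ((α + π / 2 : ℝ) : AngleCircle)) := by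
    refine Eq.symm ((rotate_unitVec _ _).trans (congrArg unitVec ?_))
    rw [AddCircle.coe_add]
    abel
  calc inner ℝ (axisCoords θ p) (unitVec (θ + (α : AngleCircle)))
      = inner ℝ (!₂[p.1, p.2] : Plane) (unitVec ((α + π / 2 : ℝ) : AngleCircle)) := by
        rw [hu]
        exact (rotateIso _).inner_map_map _ _
    _ = p.2 * Real.cos α - p.1 * Real.sin α := by
        rw [inner_plane, unitVec_apply_zero, unitVec_apply_one, angleCos_coe, angleSin_coe,
          Real.cos_add_pi_div_two, Real.sin_add_pi_div_two]
        simp only [Matrix.cons_val_zero, Matrix.cons_val_one]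
        ring

/-! ### The Fourier transform and Plancherel's theorem -/

section L2

variable {α E : Type*} [MeasurableSpace α] {μ : Measure α} [NormedAddCommGroup E]

lemma lintegral_enorm_sq_eq_eLpNorm_sq (f : α → E) :
    ∫⁻ x, ‖f x‖ₑ ^ 2 ∂μ = eLpNorm f 2 μ ^ 2 := by
  simpa using (eLpNorm_nnreal_pow_eq_lintegral (f := f) (μ := μ) (p := 2) two_ne_zero).symm

lemma memLp_two_of_integrable_of_bound {f : α → E} (hf : Integrable f μ) {B : ℝ}
    (hB : ∀ x, ‖f x‖ ≤ B) : MemLp f 2 μ := by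
  rw [memLp_two_iff_integrable_sq_norm hf.1]
  refine (hf.norm.const_mul B).mono' (hf.1.norm.pow 2) (.of_forall fun x => ?_)
  rw [Real.norm_of_nonneg (by positivity), sq]
  exact mul_le_mul_of_nonneg_right (hB x) (norm_nonneg _)

end L2

section Fourier

open scoped SchwartzMap

variable {V W E : Type*} [NormedAddCommGroup V] [InnerProductSpace ℝ V] [FiniteDimensional ℝ V]
  [MeasurableSpace V] [BorelSpace V] [NormedAddCommGroup W] [InnerProductSpace ℝ W]
  [FiniteDimensional ℝ W] [MeasurableSpace W] [BorelSpace W] [NormedAddCommGroup E]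
  [NormedSpace ℂ E]

lemma lintegral_comp_smul (f : V → ℝ≥0∞) {R : ℝ} (hR : R ≠ 0) :
    ∫⁻ x, f (R • x) = ENNReal.ofReal |(R ^ Module.finrank ℝ V)⁻¹| * ∫⁻ x, f x := by
  rw [← (measurableEmbedding_const_smul₀ (α := V) hR).lintegral_map f,
    Measure.map_addHaar_smul _ hR, lintegral_smul_measure, smul_eq_mul]

lemma fourier_indicator_image_linearIsometryEquiv (e : W ≃ₗᵢ[ℝ] V) (s : Set W) (c : E) (ξ : V) :
    𝓕 ((e '' s).indicator fun _ => c) ξ = 𝓕 (s.indicator fun _ => c) (e.symm ξ) := by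
  rw [← Real.fourier_comp_linearIsometry e.symm, e.image_eq_preimage_symm]
  rfl

lemma fourier_comp_inv_smul (f : V → E) {δ : ℝ} (hδ : δ ≠ 0) (ξ : V) :
    𝓕 (fun x => f (δ⁻¹ • x)) ξ = |δ ^ Module.finrank ℝ V| • 𝓕 f (δ • ξ) := by
  simp only [Real.fourier_eq]
  rw [← Measure.integral_comp_inv_smul (volume : Measure V)]
  simp only [real_inner_smul_left, real_inner_smul_right, mul_inv_cancel_left₀ hδ]

lemma fourier_indicator_smul (s : Set V) (c : E) {δ : ℝ} (hδ : δ ≠ 0) (ξ : V) :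
    𝓕 (((fun x => δ • x) '' s).indicator fun _ => c) ξ =
      |δ ^ Module.finrank ℝ V| • 𝓕 (s.indicator fun _ => c) (δ • ξ) := by
  rw [← fourier_comp_inv_smul _ hδ, Set.image_smul, ← Set.preimage_smul_inv₀ hδ]
  rfl

lemma fourier_ofReal_neg (f : V → ℝ) (ξ : V) :
    𝓕 (fun x => (f x : ℂ)) (-ξ) = starRingEnd ℂ (𝓕 (fun x => (f x : ℂ)) ξ) := by
  simp only [Real.fourier_eq', ← integral_conj, smul_eq_mul, map_mul, ← Complex.exp_conj,
    Complex.conj_ofReal, Complex.conj_I, inner_neg_right]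
  simp

lemma continuous_fourier {f : V → E} (hf : Integrable f) : Continuous (𝓕 f) :=
  VectorFourier.fourierIntegral_continuous Real.continuous_fourierChar
    (by exact continuous_inner) hf

lemma fourier_comp_add_sub_self {f : V → E} (hf : Integrable f) (h ξ : V) :
    𝓕 (fun x => f (x + h) - f x) ξ = ((𝐞 (inner ℝ h ξ) : ℂ) - 1) • 𝓕 f ξ := by
  have htranslate : 𝓕 (fun x => f (x + h)) ξ = (𝐞 (inner ℝ h ξ) : ℂ) • 𝓕 f ξ :=
    congrFun (VectorFourier.fourierIntegral_comp_add_right 𝐞 volume (innerₗ V) f h) ξ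
  rw [sub_smul, one_smul, ← htranslate]
  simp only [Real.fourier_eq, smul_sub]
  exact integral_sub ((Real.fourierIntegral_convergent_iff ξ).2 (hf.comp_add_right h))
    ((Real.fourierIntegral_convergent_iff ξ).2 hf)

lemma integral_schwartz_mul_fourier {f : V → ℂ} (hf : Integrable f) (g : 𝓢(V, ℂ)) :
    ∫ ξ, g ξ * 𝓕 f ξ = ∫ x, 𝓕 g x * f x := by
  have h := VectorFourier.integral_fourierIntegral_smul_eq_flip (L := innerₗ V)
    Real.continuous_fourierChar continuous_inner hf g.integrable (μ := volume) (ν := volume)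
  simp only [smul_eq_mul, flip_innerₗ, mul_comm _ (g _), mul_comm (f _)] at h
  exact h

lemma fourier_ae_eq_fourier_toLp {f : V → ℂ} (hf : Integrable f) (hf2 : MemLp f 2) :
    𝓕 f =ᵐ[volume] ((𝓕 (hf2.toLp f) : Lp ℂ 2 (volume : Measure V)) : V → ℂ) := by
  refine ae_eq_of_integral_contDiff_smul_eq (continuous_fourier hf).locallyIntegrable
    ((Lp.memLp _).locallyIntegrable (by norm_num)) fun g hg hgc => ?_
  have hgc' : HasCompactSupport fun x => (g x : ℂ) := hgc.comp_left (g := Complex.ofReal) rfl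
  let G : 𝓢(V, ℂ) := hgc'.toSchwartzMap (Complex.ofRealCLM.contDiff.comp hg)
  have hdist := congrArg (· G) (Lp.fourier_toTemperedDistribution_eq (hf2.toLp f))
  simp only [TemperedDistribution.fourier_apply, Lp.toTemperedDistribution_apply] at hdist
  calc ∫ x, g x • 𝓕 f x = ∫ x, 𝓕 G x * f x := integral_schwartz_mul_fourier hf G
    _ = ∫ x, 𝓕 G x • (hf2.toLp f) x := integral_congr_ae <| by
        filter_upwards [hf2.coeFn_toLp] with x hx
        rw [hx, smul_eq_mul]
    _ = _ := hdist

theorem lintegral_enorm_sq_fourier {f : V → ℂ} (hf : Integrable f) (hf2 : MemLp f 2) :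
    ∫⁻ ξ, ‖𝓕 f ξ‖ₑ ^ 2 = ∫⁻ x, ‖f x‖ₑ ^ 2 := by
  rw [lintegral_enorm_sq_eq_eLpNorm_sq, lintegral_enorm_sq_eq_eLpNorm_sq,
    eLpNorm_congr_ae (fourier_ae_eq_fourier_toLp hf hf2), ← eLpNorm_congr_ae hf2.coeFn_toLp,
    ← Lp.enorm_def, ← Lp.enorm_def, enorm_eq_iff_norm_eq.2 (Lp.norm_fourier_eq _)]

theorem lintegral_enorm_sq_fourier_mul_schwartz {f : V → ℂ} (hf : Integrable f) (χ : 𝓢(V, ℂ)) :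
    ∫⁻ ξ, ‖𝓕 f ξ * χ ξ‖ₑ ^ 2 = ∫⁻ x, ‖∫ y, f (x - y) * (𝓕⁻ χ : 𝓢(V, ℂ)) y‖ₑ ^ 2 := by
  set w : 𝓢(V, ℂ) := 𝓕⁻ χ
  have hconv : convolution f w (.mul ℂ ℂ) volume = fun x => ∫ y, f (x - y) * w y := by
    ext x
    rw [← convolution_flip]
    rfl
  have hint : Integrable (fun x => ∫ y, f (x - y) * w y) :=
    hconv ▸ hf.integrable_convolution (.mul ℂ ℂ) w.integrable
  have hbound : ∀ x, ‖∫ y, f (x - y) * w y‖ ≤ (∫ y, ‖f y‖) * ‖w.toBoundedContinuousFunction‖ := by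
    intro x
    rw [← integral_sub_left_eq_self (fun y => ‖f y‖) volume x, ← integral_mul_const]
    refine norm_integral_le_of_norm_le ((hf.comp_sub_left x).norm.mul_const _)
      (.of_forall fun y => ?_)
    rw [norm_mul]
    gcongr
    exact w.toBoundedContinuousFunction.norm_coe_le_norm y
  rw [← lintegral_enorm_sq_fourier hint (memLp_two_of_integrable_of_bound hint hbound), ← hconv]
  refine lintegral_congr fun ξ => ?_
  rw [Real.fourier_mul_convolution_eq hf w.integrable, ← SchwartzMap.fourier_coe,
    FourierTransform.fourier_fourierInv_eq]

end Fourier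

/-! ### The mean square bound from above -/

lemma lintegral_indicator_translate_sub_le {S : Set ℝ} (hS : S.OrdConnected)
    (hb : Bornology.IsBounded S) {t : ℝ} (ht : 0 ≤ t) :
    ∫⁻ x, ‖S.indicator (fun _ => (1 : ℂ)) (x + t) - S.indicator (fun _ => (1 : ℂ)) x‖ₑ ^ 2 ≤
      ENNReal.ofReal (2 * t) := by
  rcases S.eq_empty_or_nonempty with rfl | hne
  · simp
  set a := sInf S
  set b := sSup S
  have hlower : Set.Ioo a b ⊆ S :=
    IsConnected.Ioo_csInf_csSup_subset ⟨hne, hS.isPreconnected⟩ hb.bddBelow hb.bddAbove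
  have hupper : S ⊆ Set.Icc a b := subset_Icc_csInf_csSup hb.bddBelow hb.bddAbove
  have hshift : ∀ x ∉ Set.Icc (a - t) a ∪ Set.Icc (b - t) b, x + t ∈ S ↔ x ∈ S := by
    intro x hx
    simp only [Set.mem_union, Set.mem_Icc, not_or, not_and_or, not_le] at hx
    constructor <;> intro h <;> have hab := hupper h <;> refine hlower ?_ <;>
      rcases hx with ⟨h₁ | h₁, h₂ | h₂⟩ <;> constructor <;> linarith [hab.1, hab.2]
  calc _ ≤ ∫⁻ x, (Set.Icc (a - t) a ∪ Set.Icc (b - t) b).indicator 1 x := by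
        refine lintegral_mono fun x => ?_
        by_cases hx : x ∈ Set.Icc (a - t) a ∪ Set.Icc (b - t) b
        · rw [Set.indicator_of_mem hx, Pi.one_apply]
          by_cases h₁ : x ∈ S <;> by_cases h₂ : x + t ∈ S <;> simp [h₁, h₂]
        · by_cases h : x ∈ S <;> simp [h, hshift x hx]
    _ = volume (Set.Icc (a - t) a ∪ Set.Icc (b - t) b) :=
        lintegral_indicator_one (measurableSet_Icc.union measurableSet_Icc)
    _ ≤ volume (Set.Icc (a - t) a) + volume (Set.Icc (b - t) b) := measure_union_le _ _
    _ = ENNReal.ofReal (2 * t) := by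
        rw [Real.volume_Icc, Real.volume_Icc, sub_sub_cancel, sub_sub_cancel,
          ← ENNReal.ofReal_add ht ht, two_mul]

lemma two_mul_abs_le_norm_fourierChar_sub_one {s : ℝ} (hs : |s| ≤ 1) :
    2 * |s| ≤ ‖(𝐞 (s / 2) : ℂ) - 1‖ := by
  have hsin := Real.mul_abs_le_abs_sin (x := π * s / 2) (by
    rw [abs_div, abs_mul, abs_of_pos Real.pi_pos, abs_two]
    nlinarith [Real.pi_pos])
  have hnorm : ‖(𝐞 (s / 2) : ℂ) - 1‖ = 2 * |Real.sin (π * s / 2)| := by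
    calc ‖(𝐞 (s / 2) : ℂ) - 1‖ = ‖Complex.exp (Complex.I * (π * s : ℝ)) - 1‖ := by
          rw [Real.fourierChar_apply]
          congr 3
          push_cast
          ring
      _ = 2 * |Real.sin (π * s / 2)| := by
          rw [Complex.norm_exp_I_mul_ofReal_sub_one, norm_mul, Real.norm_ofNat, Real.norm_eq_abs]
  have hcancel : 2 / π * |π * s / 2| = |s| := by
    rw [abs_div, abs_mul, abs_of_pos Real.pi_pos, abs_two]
    field_simp
  linarith

section Translate

variable {n : ℕ} {K : Set (EuclideanSpace ℝ (Fin (n + 1)))} {B : ℝ}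

lemma integrable_indicator_one {V : Type*} [NormedAddCommGroup V] [NormedSpace ℝ V]
    [FiniteDimensional ℝ V] [MeasureSpace V] [BorelSpace V]
    [(volume : Measure V).IsAddHaarMeasure] {K : Set V} (hK : Convex ℝ K)
    (hb : Bornology.IsBounded K) : Integrable (K.indicator fun _ => (1 : ℂ)) :=
  IntegrableOn.integrable_indicator₀ (integrableOn_const hb.measure_lt_top.ne)
    (hK.nullMeasurableSet volume)

lemma lintegral_line_translate_sub_le {V : Type*} [NormedAddCommGroup V] [NormedSpace ℝ V]
    {K : Set V} (hK : Convex ℝ K) (hb : Bornology.IsBounded K) {e : V} (he : e ≠ 0) (v : V)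
    {t : ℝ} (ht : 0 ≤ t) :
    ∫⁻ s : ℝ, ‖K.indicator (fun _ => (1 : ℂ)) (v + (s + t) • e) -
      K.indicator (fun _ => (1 : ℂ)) (v + s • e)‖ₑ ^ 2 ≤ ENNReal.ofReal (2 * t) := by
  refine lintegral_indicator_translate_sub_le (S := {s : ℝ | v + s • e ∈ K}) ?_ ?_ ht
  · exact ((hK.translate_preimage_right v).linear_preimage
      (LinearMap.toSpanSingleton ℝ V e)).ordConnected
  · obtain ⟨B, hB⟩ := isBounded_iff_forall_norm_le.1 hb
    refine isBounded_iff_forall_norm_le.2 ⟨(B + ‖v‖) / ‖e‖, fun s hs => ?_⟩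
    rw [le_div_iff₀ (norm_pos_iff.2 he), ← norm_smul, ← add_sub_cancel_left v (s • e)]
    exact (norm_sub_le _ _).trans (by gcongr; exact hB _ hs)

/-- The point of `ℝⁿ⁺¹` with `i`-th coordinate `p.1` and remaining coordinates `p.2`. -/
noncomputable def insertCoord (i : Fin (n + 1)) (p : ℝ × (Fin n → ℝ)) :
    EuclideanSpace ℝ (Fin (n + 1)) :=
  WithLp.toLp 2 (i.insertNth p.1 p.2)

lemma insertCoord_self (i : Fin (n + 1)) (s : ℝ) (y : Fin n → ℝ) :
    insertCoord i (s, y) i = s :=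
  Fin.insertNth_apply_same (α := fun _ => ℝ) i s y

lemma insertCoord_succAbove (i : Fin (n + 1)) (s : ℝ) (y : Fin n → ℝ) (j : Fin n) :
    insertCoord i (s, y) (i.succAbove j) = y j :=
  Fin.insertNth_apply_succAbove (α := fun _ => ℝ) i s y j

lemma insertCoord_eq_add_smul (i : Fin (n + 1)) (s : ℝ) (y : Fin n → ℝ) :
    insertCoord i (s, y) = insertCoord i (0, y) + s • EuclideanSpace.single i 1 := by
  ext j
  obtain rfl | ⟨j, rfl⟩ := Fin.eq_self_or_eq_succAbove i j
  · simp [insertCoord_self]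
  · simp [insertCoord_succAbove]

lemma measurePreserving_insertCoord (i : Fin (n + 1)) : MeasurePreserving (insertCoord i) :=
  (PiLp.volume_preserving_toLp (Fin (n + 1))).comp
    (volume_preserving_piFinSuccAbove (fun _ => ℝ) i).symm

lemma lintegral_slice_translate_sub_le (hK : Convex ℝ K) (hB : ∀ x ∈ K, ‖x‖ ≤ B) {t : ℝ}
    (ht : 0 ≤ t) (i : Fin (n + 1)) (y : Fin n → ℝ) :
    ∫⁻ s : ℝ, ‖K.indicator (fun _ => (1 : ℂ))
          (insertCoord i (s, y) + t • EuclideanSpace.single i 1) -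
        K.indicator (fun _ => (1 : ℂ)) (insertCoord i (s, y))‖ₑ ^ 2 ≤
      (Set.Icc (fun _ => -B) (fun _ => B)).indicator (fun _ => ENNReal.ofReal (2 * t)) y := by
  by_cases hy : y ∈ Set.Icc (fun _ => -B) (fun _ => B)
  · rw [Set.indicator_of_mem hy]
    refine (lintegral_congr fun s => ?_).trans_le (lintegral_line_translate_sub_le hK
      (isBounded_iff_forall_norm_le.2 ⟨B, hB⟩) (e := EuclideanSpace.single i 1) (by simp)
      (insertCoord i (0, y)) ht)
    rw [insertCoord_eq_add_smul i s, add_smul, add_assoc]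
  · have hempty : ∀ s : ℝ, insertCoord i (s, y) ∉ K := by
      intro s hs
      have hcoord : ∀ j, |y j| ≤ B := fun j => by
        rw [← insertCoord_succAbove i s y j]
        exact (PiLp.norm_apply_le _ _).trans (hB _ hs)
      exact hy ⟨fun j => (abs_le.1 (hcoord j)).1, fun j => (abs_le.1 (hcoord j)).2⟩
    have hshift : ∀ s : ℝ, insertCoord i (s, y) + t • EuclideanSpace.single i 1 =
        insertCoord i (s + t, y) := fun s => by
      rw [insertCoord_eq_add_smul i s, insertCoord_eq_add_smul i (s + t), add_assoc, add_smul]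
    simp [hshift, hempty]

lemma lintegral_translate_sub_le (hK : Convex ℝ K) (hB : ∀ x ∈ K, ‖x‖ ≤ B) {t : ℝ} (ht : 0 ≤ t)
    (i : Fin (n + 1)) :
    ∫⁻ x, ‖K.indicator (fun _ => (1 : ℂ)) (x + t • EuclideanSpace.single i 1) -
        K.indicator (fun _ => (1 : ℂ)) x‖ₑ ^ 2 ≤
      ENNReal.ofReal (2 * t) * ENNReal.ofReal (2 * B) ^ n := by
  have hint := integrable_indicator_one hK (isBounded_iff_forall_norm_le.2 ⟨B, hB⟩)
  have hmeas : AEMeasurable fun x : EuclideanSpace ℝ (Fin (n + 1)) =>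
      ‖K.indicator (fun _ => (1 : ℂ)) (x + t • EuclideanSpace.single i 1) -
        K.indicator (fun _ => (1 : ℂ)) x‖ₑ ^ 2 :=
    ((hint.comp_add_right _).sub hint).aestronglyMeasurable.enorm.pow_const 2
  have hmp := measurePreserving_insertCoord i
  rw [← hmp.map_eq] at hmeas ⊢
  rw [lintegral_map' hmeas hmp.aemeasurable, Measure.volume_eq_prod,
    lintegral_prod_symm]
  swap
  · exact hmeas.comp_aemeasurable hmp.aemeasurable
  calc _ ≤ ∫⁻ y : Fin n → ℝ, (Set.Icc (fun _ => -B) (fun _ => B)).indicator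
          (fun _ => ENNReal.ofReal (2 * t)) y :=
        lintegral_mono (lintegral_slice_translate_sub_le hK hB ht i)
    _ = ENNReal.ofReal (2 * t) * ENNReal.ofReal (2 * B) ^ n := by
        rw [lintegral_indicator measurableSet_Icc, setLIntegral_const, Real.volume_Icc_pi]
        simp [two_mul]

lemma abs_inner_mul_norm_fourier_le {V : Type*} [NormedAddCommGroup V] [InnerProductSpace ℝ V]
    [FiniteDimensional ℝ V] [MeasurableSpace V] [BorelSpace V] {f : V → ℂ} (hf : Integrable f)
    {h ξ : V} (hξ : |2 * inner ℝ h ξ| ≤ 1) :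
    |2 * inner ℝ h ξ| * ‖𝓕 f ξ‖ ≤ ‖𝓕 (fun x => f (x + h) - f x) ξ‖ := by
  have hchar := two_mul_abs_le_norm_fourierChar_sub_one hξ
  rw [mul_div_cancel_left₀ _ two_ne_zero] at hchar
  rw [fourier_comp_add_sub_self hf, norm_smul]
  gcongr
  linarith [abs_nonneg (2 * inner ℝ h ξ)]

lemma lintegral_coord_mul_fourier_indicator_le (hK : Convex ℝ K) (hB : ∀ x ∈ K, ‖x‖ ≤ B) {ρ : ℝ}
    (hρ : 0 < ρ) (i : Fin (n + 1)) :
    ∫⁻ ξ in Metric.closedBall 0 1,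
        ‖(ξ i : ℂ) * 𝓕 (K.indicator fun _ => (1 : ℂ)) (ρ • ξ)‖ₑ ^ 2 ≤
      ENNReal.ofReal (ρ ^ (n + 2))⁻¹ * ENNReal.ofReal (2 * B) ^ n := by
  set f : EuclideanSpace ℝ (Fin (n + 1)) → ℂ := K.indicator fun _ => (1 : ℂ)
  set h : EuclideanSpace ℝ (Fin (n + 1)) := (2 * ρ)⁻¹ • EuclideanSpace.single i 1 with h_def
  have hf : Integrable f := integrable_indicator_one hK (isBounded_iff_forall_norm_le.2 ⟨B, hB⟩)
  have hsub : Integrable fun x => f (x + h) - f x := (hf.comp_add_right h).sub hf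
  have hf_le : ∀ x, ‖f x‖ ≤ 1 := fun x =>
    (norm_indicator_le_norm_self _ _).trans norm_one.le
  have hsub2 : MemLp (fun x => f (x + h) - f x) 2 :=
    memLp_two_of_integrable_of_bound hsub fun x =>
      (norm_sub_le _ _).trans (add_le_add (hf_le _) (hf_le _))
  have hinner : ∀ ξ : EuclideanSpace ℝ (Fin (n + 1)), 2 * inner ℝ h (ρ • ξ) = ξ i := fun ξ => by
    rw [h_def, real_inner_smul_left, real_inner_smul_right, EuclideanSpace.inner_single_left,
      map_one, one_mul]
    field_simp
  have hpointwise : ∀ ξ ∈ Metric.closedBall (0 : EuclideanSpace ℝ (Fin (n + 1))) 1,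
      ‖(ξ i : ℂ) * 𝓕 f (ρ • ξ)‖ₑ ^ 2 ≤ ‖𝓕 (fun x => f (x + h) - f x) (ρ • ξ)‖ₑ ^ 2 := fun ξ hξ => by
    have hξi : |ξ i| ≤ 1 := (PiLp.norm_apply_le ξ i).trans (mem_closedBall_zero_iff.1 hξ)
    gcongr ?_ ^ 2
    rw [enorm_le_iff_norm_le, norm_mul, Complex.norm_real, Real.norm_eq_abs, ← hinner]
    exact abs_inner_mul_norm_fourier_le hf (by rwa [hinner])
  calc _ ≤ ∫⁻ ξ, ‖𝓕 (fun x => f (x + h) - f x) (ρ • ξ)‖ₑ ^ 2 :=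
        (setLIntegral_mono' measurableSet_closedBall hpointwise).trans
          (setLIntegral_le_lintegral _ _)
    _ = ENNReal.ofReal |(ρ ^ (n + 1))⁻¹| * ∫⁻ x, ‖f (x + h) - f x‖ₑ ^ 2 := by
        rw [lintegral_comp_smul (fun ξ => ‖𝓕 (fun x => f (x + h) - f x) ξ‖ₑ ^ 2) hρ.ne',
          lintegral_enorm_sq_fourier hsub hsub2, finrank_euclideanSpace_fin]
    _ ≤ ENNReal.ofReal |(ρ ^ (n + 1))⁻¹| *
          (ENNReal.ofReal (2 * (2 * ρ)⁻¹) * ENNReal.ofReal (2 * B) ^ n) := by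
        gcongr
        exact lintegral_translate_sub_le hK hB (by positivity) i
    _ = ENNReal.ofReal (ρ ^ (n + 2))⁻¹ * ENNReal.ofReal (2 * B) ^ n := by
        rw [← mul_assoc, ← ENNReal.ofReal_mul (by positivity), abs_of_pos (by positivity)]
        congr 2
        field_simp
        ring

theorem lintegral_norm_mul_fourier_indicator_le (hK : Convex ℝ K) (hB : ∀ x ∈ K, ‖x‖ ≤ B)
    {ρ : ℝ} (hρ : 0 < ρ) :
    ∫⁻ ξ in Metric.closedBall 0 1,
        ENNReal.ofReal (‖ξ‖ ^ 2 * ‖𝓕 (K.indicator fun _ => (1 : ℂ)) (ρ • ξ)‖ ^ 2) ≤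
      (n + 1) * (ENNReal.ofReal (ρ ^ (n + 2))⁻¹ * ENNReal.ofReal (2 * B) ^ n) := by
  have hcont := continuous_fourier
    (integrable_indicator_one hK (isBounded_iff_forall_norm_le.2 ⟨B, hB⟩))
  have hsum : ∀ ξ : EuclideanSpace ℝ (Fin (n + 1)),
      ENNReal.ofReal (‖ξ‖ ^ 2 * ‖𝓕 (K.indicator fun _ => (1 : ℂ)) (ρ • ξ)‖ ^ 2) =
        ∑ i, ‖(ξ i : ℂ) * 𝓕 (K.indicator fun _ => (1 : ℂ)) (ρ • ξ)‖ₑ ^ 2 := fun ξ => by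
    rw [EuclideanSpace.norm_sq_eq, Finset.sum_mul,
      ENNReal.ofReal_sum_of_nonneg fun i _ => by positivity]
    refine Finset.sum_congr rfl fun i _ => ?_
    rw [← ofReal_norm, ← ENNReal.ofReal_pow (norm_nonneg _), norm_mul, mul_pow, Complex.norm_real]
  simp only [hsum]
  rw [lintegral_finsetSum _ fun i _ => by fun_prop]
  refine (Finset.sum_le_sum fun i _ =>
    lintegral_coord_mul_fourier_indicator_le hK hB hρ i).trans_eq ?_
  simp

end Translate

/-! ### Nearly flat pieces of the boundary -/

lemma abs_sub_le_of_convexOn_of_support {f : ℝ → ℝ} {a b m n s : ℝ}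
    (hf : ConvexOn ℝ (Set.Icc a b) f) (ha : ∀ x ∈ Set.Icc a b, f a + m * (x - a) ≤ f x)
    (hb : ∀ x ∈ Set.Icc a b, f b + n * (x - b) ≤ f x) (hm : |m| ≤ s) (hn : |n| ≤ s) {x y : ℝ}
    (hx : x ∈ Set.Icc a b) (hy : y ∈ Set.Icc a b) : |f y - f x| ≤ s * |y - x| := by
  wlog hxy : x < y generalizing x y
  · rcases (not_lt.1 hxy).eq_or_lt with rfl | h
    · simp
    · rw [abs_sub_comm, abs_sub_comm y]
      exact this hy hx h
  have hab : a ≤ b := hx.1.trans hx.2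
  have hay : a < y := hx.1.trans_lt hxy
  have hxb : x < b := hxy.trans_le hy.2
  have hupper : f y - f x ≤ n * (y - x) := by
    rw [← div_le_iff₀ (sub_pos.2 hxy)]
    refine (hf.secant_mono hx hy (Set.right_mem_Icc.2 hab) hxy.ne' hxb.ne' hy.2).trans ?_
    rw [div_le_iff₀ (sub_pos.2 hxb)]
    linarith [hb x hx]
  have hlower : m * (y - x) ≤ f y - f x := by
    rw [← le_div_iff₀ (sub_pos.2 hxy), ← neg_div_neg_eq, neg_sub, neg_sub]
    refine le_trans ?_ (hf.secant_mono hy (Set.left_mem_Icc.2 hab) hx hay.ne hxy.ne hx.1)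
    rw [le_div_iff_of_neg (sub_neg.2 hay)]
    linarith [ha y hy]
  have hpos : 0 ≤ y - x := (sub_pos.2 hxy).le
  rw [abs_of_nonneg hpos, abs_le]
  exact ⟨by nlinarith [(abs_le.1 hm).1], by nlinarith [(abs_le.1 hn).2]⟩

/-- The function whose graph is the lower boundary of `K`; it is meaningful over the projection
of `K` to the first axis. -/
noncomputable def lowerBoundary (K : Set (ℝ × ℝ)) (x : ℝ) : ℝ := sInf {y | (x, y) ∈ K}

/-- The line of slope `m` through the point `p` of `K` supports `K` from below. -/
structure IsLowerSupport (K : Set (ℝ × ℝ)) (m : ℝ) (p : ℝ × ℝ) : Prop where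
  mem : p ∈ K
  le : ∀ q ∈ K, p.2 + m * (q.1 - p.1) ≤ q.2

/-- The lower boundary of `K` contains the graph of `f` over `[a, b]`, and in the square of
half-side `r` around each of its points `K` differs from a half plane only in the double wedge
between the slopes `-s` and `s`. -/
def HasFlatGraph (K : Set (ℝ × ℝ)) (s a b r : ℝ) (f : ℝ → ℝ) : Prop :=
  ∀ x ∈ Set.Icc a b, ∀ v : ℝ × ℝ, ‖v‖ ≤ r →
    (s * |v.1| ≤ v.2 → (x, f x) + v ∈ K) ∧ (v.2 < -(s * |v.1|) → (x, f x) + v ∉ K)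

section LowerBoundary

variable {K : Set (ℝ × ℝ)}

lemma isCompact_slice (hK : IsCompact K) (x : ℝ) : IsCompact {y | (x, y) ∈ K} :=
  (hK.image continuous_snd).of_isClosed_subset
    (hK.isClosed.preimage (Continuous.prodMk_right x)) fun _ hy => ⟨_, hy, rfl⟩

lemma lowerBoundary_le (hK : IsCompact K) {p : ℝ × ℝ} (hp : p ∈ K) :
    lowerBoundary K p.1 ≤ p.2 :=
  csInf_le (isCompact_slice hK p.1).bddBelow hp

lemma lowerBoundary_mem (hK : IsCompact K) {x : ℝ} (hx : x ∈ Prod.fst '' K) :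
    (x, lowerBoundary K x) ∈ K := by
  obtain ⟨p, hp, rfl⟩ := hx
  exact (isCompact_slice hK p.1).sInf_mem ⟨p.2, hp⟩

lemma IsLowerSupport.lowerBoundary_eq (hK : IsCompact K) {m : ℝ} {p : ℝ × ℝ}
    (hp : IsLowerSupport K m p) : lowerBoundary K p.1 = p.2 := by
  refine le_antisymm (lowerBoundary_le hK hp.mem) ?_
  simpa using hp.le _ (lowerBoundary_mem hK ⟨p, hp.mem, rfl⟩)

lemma convexOn_lowerBoundary (hconv : Convex ℝ K) (hK : IsCompact K) :
    ConvexOn ℝ (Prod.fst '' K) (lowerBoundary K) :=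
  ⟨hconv.linear_image (LinearMap.fst ℝ ℝ ℝ), fun _ hx _ hy _ _ hu hv huv =>
    lowerBoundary_le hK (hconv (lowerBoundary_mem hK hx) (lowerBoundary_mem hK hy) hu hv huv)⟩

lemma abs_lowerBoundary_sub_le (hconv : Convex ℝ K) (hK : IsCompact K) {m n s : ℝ} {l r : ℝ × ℝ}
    (hl : IsLowerSupport K m l) (hr : IsLowerSupport K n r) (hm : |m| ≤ s) (hn : |n| ≤ s)
    {x y : ℝ} (hx : x ∈ Set.Icc l.1 r.1) (hy : y ∈ Set.Icc l.1 r.1) :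
    |lowerBoundary K y - lowerBoundary K x| ≤ s * |y - x| := by
  have hsub : Set.Icc l.1 r.1 ⊆ Prod.fst '' K :=
    (hconv.linear_image (LinearMap.fst ℝ ℝ ℝ)).ordConnected.out ⟨l, hl.mem, rfl⟩ ⟨r, hr.mem, rfl⟩
  have hf := (convexOn_lowerBoundary hconv hK).subset hsub (convex_Icc _ _)
  refine abs_sub_le_of_convexOn_of_support hf (fun z hz => ?_) (fun z hz => ?_) hm hn hx hy
  · rw [hl.lowerBoundary_eq hK]
    exact hl.le _ (lowerBoundary_mem hK (hsub hz))
  · rw [hr.lowerBoundary_eq hK]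
    exact hr.le _ (lowerBoundary_mem hK (hsub hz))

lemma exists_mem_interior_fst_mem_Ioo (hconv : Convex ℝ K) (hint : (interior K).Nonempty)
    {l r : ℝ × ℝ} (hl : l ∈ K) (hr : r ∈ K) (hlr : l.1 < r.1) :
    ∃ w ∈ interior K, w.1 ∈ Set.Ioo l.1 r.1 := by
  have hmid : midpoint ℝ l r ∈ closure (interior K) := by
    rw [hconv.closure_interior_eq_closure_of_nonempty_interior hint]
    exact subset_closure (hconv.midpoint_mem hl hr)
  have hfst : (midpoint ℝ l r).1 ∈ Set.Ioo l.1 r.1 := by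
    rw [midpoint_eq_smul_add, Prod.smul_fst, Prod.fst_add, smul_eq_mul, invOf_eq_inv]
    constructor <;> linarith
  obtain ⟨w, hw, hwint⟩ :=
    mem_closure_iff.1 hmid _ (isOpen_Ioo.preimage continuous_fst) hfst
  exact ⟨w, hwint, hw⟩

lemma ordConnected_slice (hconv : Convex ℝ K) (x : ℝ) : ({y | (x, y) ∈ K}).OrdConnected := by
  have hslice : {y | (x, y) ∈ K} = LinearMap.inr ℝ ℝ ℝ ⁻¹' ((fun p => (x, 0) + p) ⁻¹' K) := by
    ext y
    simp
  rw [hslice]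
  exact ((hconv.translate_preimage_right (x, 0)).linear_preimage
    (LinearMap.inr ℝ ℝ ℝ)).ordConnected

lemma hasFlatGraph_of_closedBall_subset (hconv : Convex ℝ K) (hK : IsCompact K) {w : ℝ × ℝ}
    {κ s : ℝ} (hs : 0 ≤ s) (hκ : 0 < κ) (hball : Metric.closedBall w κ ⊆ K)
    (hlip : ∀ x y, |x - w.1| ≤ κ → |y - w.1| ≤ κ →
      |lowerBoundary K y - lowerBoundary K x| ≤ s * |y - x|) :
    HasFlatGraph K s (w.1 - κ / (s + 2)) (w.1 + κ / (s + 2)) (κ / (s + 2)) (lowerBoundary K) := by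
  intro x hx v hv
  set η := κ / (s + 2)
  have hη : 0 < η := by positivity
  have hηκ : (s + 2) * η = κ := by simp only [η]; field_simp
  obtain ⟨hv₁, hv₂⟩ : |v.1| ≤ η ∧ |v.2| ≤ η := max_le_iff.1 hv
  have hxw : |x - w.1| ≤ η := abs_le.2 ⟨by linarith [hx.1], by linarith [hx.2]⟩
  have hxκ : |x - w.1| ≤ κ := hxw.trans (by nlinarith)
  have hxv : |x + v.1 - w.1| ≤ κ := by
    rw [add_sub_right_comm]
    exact (abs_add_le _ _).trans (by nlinarith)
  have hself : |w.1 - w.1| ≤ κ := by simpa using hκ.le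
  have hstep := abs_le.1 (hlip x (x + v.1) hxκ hxv)
  rw [add_sub_cancel_left] at hstep
  constructor
  · intro hslope
    have htop : (x + v.1, w.2) ∈ K := hball (max_le hxv ((dist_self _).trans_le hκ.le))
    have hbase : lowerBoundary K w.1 ≤ w.2 - κ :=
      lowerBoundary_le hK (p := (w.1, w.2 - κ))
        (hball (max_le hself (by simp [abs_of_pos hκ])))
    have hdrop := abs_le.1 (hlip w.1 x hself hxκ)
    refine (ordConnected_slice hconv (x + v.1)).out (lowerBoundary_mem hK ⟨_, htop, rfl⟩) htop
      ⟨by linarith, ?_⟩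
    change lowerBoundary K x + v.2 ≤ w.2
    nlinarith [mul_le_mul_of_nonneg_left hxw hs, (abs_le.1 hv₂).2]
  · intro hslope hmem
    have := lowerBoundary_le hK hmem
    simp only [Prod.fst_add, Prod.snd_add] at this
    linarith

theorem exists_hasFlatGraph_of_isLowerSupport (hconv : Convex ℝ K) (hK : IsCompact K)
    (hint : (interior K).Nonempty) {m n s : ℝ} {l r : ℝ × ℝ} (hl : IsLowerSupport K m l)
    (hr : IsLowerSupport K n r) (hm : |m| ≤ s) (hn : |n| ≤ s) (hlr : l.1 < r.1) :
    ∃ a b δ, a < b ∧ 0 < δ ∧ HasFlatGraph K s a b δ (lowerBoundary K) := by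
  have hs : 0 ≤ s := (abs_nonneg m).trans hm
  obtain ⟨w, hw, hwlr⟩ := exists_mem_interior_fst_mem_Ioo hconv hint hl.mem hr.mem hlr
  obtain ⟨κ, hκ, hball⟩ := Metric.nhds_basis_closedBall.mem_iff.1
    (Filter.inter_mem (mem_interior_iff_mem_nhds.1 hw)
      ((isOpen_Ioo.preimage continuous_fst).mem_nhds hwlr))
  have hstrip : ∀ x, |x - w.1| ≤ κ → x ∈ Set.Icc l.1 r.1 := fun x hx =>
    Set.Ioo_subset_Icc_self
      (hball (show (x, w.2) ∈ Metric.closedBall w κ from max_le hx (by simpa using hκ.le))).2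
  have hη : 0 < κ / (s + 2) := by positivity
  exact ⟨_, _, _, by linarith, hη,
    hasFlatGraph_of_closedBall_subset hconv hK hs hκ (fun p hp => (hball hp).1) fun x y hx hy =>
      abs_lowerBoundary_sub_le hconv hK hl hr hm hn (hstrip x hx) (hstrip y hy)⟩

end LowerBoundary

section NormalAngles

open Filter Topology

variable {C : Set Plane} {θ : AngleCircle} {p : Plane}

lemma mem_frontier_of_mem_normalAngles (hp : p ∈ closure C) (hθ : θ ∈ normalAngles C p) :
    p ∈ frontier C := by
  refine ⟨hp, fun hint => ?_⟩
  have hmin : IsLocalMin (fun a : Plane => innerSL ℝ (unitVec θ) a) p := by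
    filter_upwards [mem_interior_iff_mem_nhds.1 hint] with a ha
    rw [innerSL_apply_apply, innerSL_apply_apply, real_inner_comm, real_inner_comm a]
    exact hθ.2 ⟨a, subset_closure ha, rfl⟩
  have hzero := hmin.hasFDerivAt_eq_zero (innerSL ℝ (unitVec θ)).hasFDerivAt
  have := congrArg norm hzero
  simp at this

lemma frequently_notMem_normalAngles (hp : p ∈ frontier C) (hθ : θ ∉ angularTrace C) :
    ∃ᶠ α : ℝ in 𝓝 0, θ + (α : AngleCircle) ∉ normalAngles C p := by
  refine not_eventually.1 fun hev => hθ (Set.mem_iUnion₂.2 ⟨p, hp, mem_interior_iff_mem_nhds.2 ?_⟩)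
  have hopen : IsOpenMap fun α : ℝ => θ + (α : AngleCircle) :=
    (isOpenMap_add_left θ).comp QuotientAddGroup.isOpenMap_coe
  have himage := hopen.image_mem_nhds hev
  rw [AddCircle.coe_zero, add_zero] at himage
  exact mem_of_superset himage (Set.image_subset_iff.2 fun _ => id)

lemma add_mem_normalAngles_iff {α : ℝ} (hα : 0 < Real.cos α) {q : ℝ × ℝ}
    (hq : axisCoords θ q ∈ closure C) :
    θ + (α : AngleCircle) ∈ normalAngles C (axisCoords θ q) ↔
      IsLowerSupport (axisCoords θ ⁻¹' closure C) (Real.tan α) q := by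
  have hmono : ∀ q' : ℝ × ℝ, q.2 * Real.cos α - q.1 * Real.sin α ≤
      q'.2 * Real.cos α - q'.1 * Real.sin α ↔ q.2 + Real.tan α * (q'.1 - q.1) ≤ q'.2 := by
    intro q'
    rw [← Real.tan_mul_cos hα.ne', ← mul_assoc, ← mul_assoc, ← sub_mul, ← sub_mul,
      mul_le_mul_iff_left₀ hα]
    constructor <;> intro h <;> linarith
  constructor
  · refine fun h => ⟨hq, fun q' hq' => (hmono q').1 ?_⟩
    rw [← inner_axisCoords θ, ← inner_axisCoords θ]
    exact h.2 ⟨_, hq', rfl⟩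
  · rintro ⟨-, hsupp⟩
    refine ⟨⟨_, hq, rfl⟩, ?_⟩
    rintro _ ⟨x, hx, rfl⟩
    obtain ⟨q', rfl⟩ := (axisCoords θ).surjective x
    simp only [inner_axisCoords]
    exact (hmono q').2 (hsupp q' hx)

lemma exists_isLowerSupport {K : Set (ℝ × ℝ)} (hK : IsCompact K) (hne : K.Nonempty) (m : ℝ) :
    ∃ q, IsLowerSupport K m q := by
  obtain ⟨q, hq, hmin⟩ := hK.exists_isMinOn (f := fun q : ℝ × ℝ => q.2 - m * q.1) hne
    (by fun_prop)
  refine ⟨q, hq, fun q' hq' => ?_⟩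
  have : q.2 - m * q.1 ≤ q'.2 - m * q'.1 := hmin hq'
  linarith

lemma exists_isLowerSupport_lt_of_notMem_angularTrace (hC : Bornology.IsBounded C)
    (hne : C.Nonempty) (hθ : θ ∉ angularTrace C) {s : ℝ} (hs : 0 < s) :
    ∃ m n l r, |m| ≤ s ∧ |n| ≤ s ∧ IsLowerSupport (axisCoords θ ⁻¹' closure C) m l ∧
      IsLowerSupport (axisCoords θ ⁻¹' closure C) n r ∧ l.1 < r.1 := by
  have hK : IsCompact (axisCoords θ ⁻¹' closure C) :=
    (axisCoords θ).toHomeomorph.isCompact_preimage.2 hC.isCompact_closure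
  have hKne : (axisCoords θ ⁻¹' closure C).Nonempty :=
    hne.closure.preimage (axisCoords θ).surjective
  obtain ⟨q₀, hq₀⟩ := exists_isLowerSupport hK hKne 0
  have hfront : axisCoords θ q₀ ∈ frontier C := by
    refine mem_frontier_of_mem_normalAngles hq₀.mem (θ := θ + ((0 : ℝ) : AngleCircle)) ?_
    exact (add_mem_normalAngles_iff (by simp) hq₀.mem).2 (by simpa using hq₀)
  have hcos : ∀ᶠ α : ℝ in 𝓝 0, 0 < Real.cos α :=
    Real.continuous_cos.continuousAt.eventually (lt_mem_nhds (by simp))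
  have htan : ∀ᶠ α : ℝ in 𝓝 0, |Real.tan α| < s :=
    (Real.continuousAt_tan.2 (by simp)).abs.eventually (gt_mem_nhds (by simpa using hs))
  obtain ⟨α, hα, hcosα, htanα⟩ :=
    ((frequently_notMem_normalAngles hfront hθ).and_eventually (hcos.and htan)).exists
  obtain ⟨q₁, hq₁⟩ := exists_isLowerSupport hK hKne (Real.tan α)
  have hne₁ : q₀.1 ≠ q₁.1 := fun h => by
    have h₀ := hq₀.le _ hq₁.mem
    have h₁ := hq₁.le _ hq₀.mem
    rw [h, sub_self, mul_zero, add_zero] at h₀ h₁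
    have : q₀ = q₁ := Prod.ext h (h₀.antisymm h₁)
    exact hα ((add_mem_normalAngles_iff hcosα hq₀.mem).2 (this ▸ hq₁))
  have hzero : |(0 : ℝ)| ≤ s := by simpa using hs.le
  rcases hne₁.lt_or_gt with h | h
  · exact ⟨_, _, q₀, q₁, hzero, htanα.le, hq₀, hq₁, h⟩
  · exact ⟨_, _, q₁, q₀, htanα.le, hzero, hq₁, hq₀, h⟩

theorem exists_hasFlatGraph_of_notMem_angularTrace (hC : IsPlanarConvexBody C)
    (hθ : θ ∉ angularTrace C) {s : ℝ} (hs : 0 < s) :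
    ∃ a b r f, a < b ∧ 0 < r ∧ HasFlatGraph (axisCoords θ ⁻¹' closure C) s a b r f := by
  obtain ⟨m, n, l, r, hm, hn, hl, hr, hlr⟩ := exists_isLowerSupport_lt_of_notMem_angularTrace
    hC.bounded (hC.nonempty_interior.mono interior_subset) hθ hs
  have hconv : Convex ℝ (axisCoords θ ⁻¹' closure C) :=
    hC.convex.closure.linear_preimage (axisCoords θ).toLinearMap
  have hK : IsCompact (axisCoords θ ⁻¹' closure C) :=
    (axisCoords θ).toHomeomorph.isCompact_preimage.2 hC.bounded.isCompact_closure
  have hint : (interior (axisCoords θ ⁻¹' closure C)).Nonempty := by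
    rw [show interior (axisCoords θ ⁻¹' closure C) = axisCoords θ ⁻¹' interior (closure C) from
      ((axisCoords θ).toHomeomorph.preimage_interior _).symm]
    exact (hC.nonempty_interior.mono (interior_mono subset_closure)).preimage
      (axisCoords θ).surjective
  obtain ⟨a, b, δ, hflat⟩ := exists_hasFlatGraph_of_isLowerSupport hconv hK hint hl hr hm hn hlr
  exact ⟨a, b, δ, _, hflat⟩

end NormalAngles

/-! ### Smoothed indicator functions near a flat piece of the boundary -/

section SetIntegral

open Filter Topology

variable {α E : Type*} [MeasurableSpace α] {μ : Measure α} [NormedAddCommGroup E] {w : α → E}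

lemma norm_setIntegral_sub_setIntegral_le [NormedSpace ℝ E] (hw : Integrable w μ) {S H Z : Set α}
    (hS : MeasurableSet S) (hH : MeasurableSet H) (hZ : MeasurableSet Z)
    (h : ∀ y ∉ Z, (y ∈ S ↔ y ∈ H)) :
    ‖∫ y in S, w y ∂μ - ∫ y in H, w y ∂μ‖ ≤ ∫ y in Z, ‖w y‖ ∂μ := by
  rw [← integral_indicator hS, ← integral_indicator hH, ← integral_indicator hZ,
    ← integral_sub (hw.indicator hS) (hw.indicator hH)]
  refine norm_integral_le_of_norm_le (hw.norm.indicator hZ) (Eventually.of_forall fun y => ?_)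
  by_cases hy : y ∈ Z
  · rw [Set.indicator_of_mem hy]
    by_cases hyS : y ∈ S <;> by_cases hyH : y ∈ H <;> simp [hyS, hyH]
  · by_cases hyS : y ∈ S
    · simp [hyS, (h y hy).1 hyS, hy]
    · simp [hyS, mt (h y hy).2 hyS, hy]

lemma exists_setIntegral_norm_le (hw : Integrable w μ) {Z : ℕ → Set α}
    (hZ : ∀ n, MeasurableSet (Z n)) (hanti : Antitone Z) (hnull : μ (⋂ n, Z n) = 0) {ε : ℝ}
    (hε : 0 < ε) : ∃ n, ∫ y in Z n, ‖w y‖ ∂μ ≤ ε := by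
  have h := tendsto_setIntegral_of_antitone (f := fun y => ‖w y‖) hZ hanti
    ⟨0, hw.norm.integrableOn⟩
  rw [setIntegral_measure_zero _ hnull] at h
  obtain ⟨n, hn⟩ := (h.eventually (gt_mem_nhds hε)).exists
  exact ⟨n, hn.le⟩

end SetIntegral

/-- The exceptional set for replacing a graph of slope at most `s` passing near the height `t` by
the horizontal line of that height: off it, a point of the plane lies on the same side of both. The
far points `1 ≤ s * ‖y‖` are included because the slope is only controlled locally. -/
def flatError (t s : ℝ) : Set (ℝ × ℝ) := {y | |t - y.2| ≤ s * (|y.1| + 1) ∨ 1 ≤ s * ‖y‖}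

lemma measurableSet_flatError (t s : ℝ) : MeasurableSet (flatError t s) :=
  MeasurableSet.union (s₁ := {y : ℝ × ℝ | |t - y.2| ≤ s * (|y.1| + 1)}) (s₂ := {y | 1 ≤ s * ‖y‖})
    (measurableSet_le (by fun_prop) (by fun_prop)) (measurableSet_le (by fun_prop) (by fun_prop))

section HalfPlane

open Filter Topology

lemma measurableSet_snd_le (t : ℝ) : MeasurableSet {y : ℝ × ℝ | y.2 ≤ t} :=
  measurableSet_le measurable_snd measurable_const

lemma volume_iInter_flatError (t : ℝ) : volume (⋂ n : ℕ, flatError t (1 / ((n : ℝ) + 1))) = 0 := by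
  have hline : volume (Set.univ ×ˢ {t} : Set (ℝ × ℝ)) = 0 := by
    rw [Measure.volume_eq_prod, Measure.prod_prod, Real.volume_singleton, mul_zero]
  refine measure_mono_null (fun y hy => Set.mk_mem_prod (Set.mem_univ _) ?_) hline
  by_contra hne
  have hlim : ∀ c : ℝ, Tendsto (fun n : ℕ => 1 / ((n : ℝ) + 1) * c) atTop (𝓝 0) := fun c => by
    simpa using (tendsto_one_div_add_atTop_nhds_zero_nat (𝕜 := ℝ)).mul_const c
  have hslope := (hlim (|y.1| + 1)).eventually
    (gt_mem_nhds (abs_pos.2 (sub_ne_zero.2 (Ne.symm hne) : t - y.2 ≠ 0)))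
  have hnorm := (hlim ‖y‖).eventually (gt_mem_nhds one_pos)
  obtain ⟨n, hn₁, hn₂⟩ := (hslope.and hnorm).exists
  exact (Set.mem_iInter.1 hy n).elim hn₁.not_ge hn₂.not_ge

lemma exists_setIntegral_flatError_le {E : Type*} [NormedAddCommGroup E] {w : ℝ × ℝ → E}
    (hw : Integrable w) (t : ℝ) {ε : ℝ} (hε : 0 < ε) :
    ∃ s > 0, ∫ y in flatError t s, ‖w y‖ ≤ ε := by
  have hanti : Antitone fun n : ℕ => flatError t (1 / ((n : ℝ) + 1)) := by
    intro m n hmn y hy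
    have hle := Nat.one_div_le_one_div (α := ℝ) hmn
    exact hy.imp (fun h => h.trans (by gcongr)) fun h => h.trans (by gcongr)
  obtain ⟨n, hn⟩ := exists_setIntegral_norm_le hw (fun n => measurableSet_flatError t _) hanti
    (volume_iInter_flatError t) hε
  exact ⟨_, Nat.one_div_pos_of_nat, hn⟩

lemma HasFlatGraph.mem_iff {K : Set (ℝ × ℝ)} {s a b δ : ℝ} {f : ℝ → ℝ}
    (hflat : HasFlatGraph K s a b δ f) {R t t₀ x : ℝ} (hR : 0 < R) (hs : 0 < s)
    (hRδ : 1 / s + |t₀| + s ≤ δ * R) (hx : x ∈ Set.Icc a b) (ht : |t - t₀| ≤ s) {y : ℝ × ℝ}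
    (hy : y ∉ flatError t₀ s) :
    R⁻¹ • ((R * x, R * f x + t) - y) ∈ K ↔ y.2 ≤ t₀ := by
  obtain ⟨hslope, hnorm⟩ : s * (|y.1| + 1) < |t₀ - y.2| ∧ ‖y‖ < 1 / s := by
    rw [lt_div_iff₀' hs]
    simpa [flatError] using hy
  set v : ℝ × ℝ := R⁻¹ • (-y.1, t - y.2)
  have hpoint : R⁻¹ • ((R * x, R * f x + t) - y) = (x, f x) + v := by
    ext <;> simp [v] <;> field_simp <;> ring
  have hv₁ : |v.1| = R⁻¹ * |y.1| := by simp [v, abs_mul, abs_of_pos hR]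
  have hv : ‖v‖ ≤ δ := by
    have ht' : |t - y.2| ≤ |t - t₀| + |t₀| + |y.2| := by
      have := abs_add_three (t - t₀) t₀ (-y.2)
      rwa [abs_neg, sub_add_cancel, ← sub_eq_add_neg] at this
    have hle : ‖((-y.1, t - y.2) : ℝ × ℝ)‖ ≤ δ * R := by
      refine max_le ?_ ?_
      · rw [norm_neg]
        linarith [norm_fst_le y, abs_nonneg t₀]
      · rw [Real.norm_eq_abs]
        linarith [norm_snd_le y, Real.norm_eq_abs y.2]
    rw [norm_smul, norm_inv, Real.norm_of_nonneg hR.le, inv_mul_le_iff₀ hR]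
    linarith
  obtain ⟨habove, hbelow⟩ := hflat x hx v hv
  rw [hpoint]
  rw [hv₁, mul_left_comm] at habove hbelow
  have ht' := abs_le.1 ht
  constructor
  · refine fun hmem => not_lt.1 fun hlt => hbelow ?_ hmem
    rw [abs_of_neg (sub_neg.2 hlt)] at hslope
    rw [← mul_neg]
    exact mul_lt_mul_of_pos_left (by linarith) (inv_pos.2 hR)
  · refine fun hle => habove ?_
    rw [abs_of_nonneg (sub_nonneg.2 hle)] at hslope
    exact mul_le_mul_of_nonneg_left (by linarith) (inv_pos.2 hR).le

lemma le_norm_setIntegral_of_hasFlatGraph {E : Type*} [NormedAddCommGroup E] [NormedSpace ℝ E]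
    {w : ℝ × ℝ → E} (hw : Integrable w) {K : Set (ℝ × ℝ)} (hK : MeasurableSet K)
    {s a b δ : ℝ} {f : ℝ → ℝ} (hflat : HasFlatGraph K s a b δ f) {R t t₀ x : ℝ} (hR : 0 < R)
    (hs : 0 < s) (hRδ : 1 / s + |t₀| + s ≤ δ * R) (hx : x ∈ Set.Icc a b) (ht : |t - t₀| ≤ s) :
    ‖∫ y in {y : ℝ × ℝ | y.2 ≤ t₀}, w y‖ - ∫ y in flatError t₀ s, ‖w y‖ ≤
      ‖∫ y in {y | R⁻¹ • ((R * x, R * f x + t) - y) ∈ K}, w y‖ := by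
  have hclose := norm_setIntegral_sub_setIntegral_le hw
    (((measurable_const.sub measurable_id).const_smul R⁻¹) hK) (measurableSet_snd_le t₀)
    (measurableSet_flatError t₀ s) fun y hy => hflat.mem_iff hR hs hRδ hx ht hy
  rw [norm_sub_rev] at hclose
  exact sub_le_comm.1 ((norm_sub_norm_le _ _).trans hclose)

lemma lintegral_ge_of_le_on_tube {F : ℝ × ℝ → ℝ≥0∞} (hF : Measurable F) {c : ℝ≥0∞}
    {a b t₀ s : ℝ} {g : ℝ → ℝ}
    (h : ∀ x ∈ Set.Icc a b, ∀ t, |t - t₀| ≤ s → c ≤ F (x, g x + t)) :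
    c * ENNReal.ofReal (2 * s) * ENNReal.ofReal (b - a) ≤ ∫⁻ p, F p := by
  have hline : ∀ x ∈ Set.Icc a b, c * ENNReal.ofReal (2 * s) ≤ ∫⁻ t, F (x, t) := fun x hx =>
    calc c * ENNReal.ofReal (2 * s)
        = ∫⁻ _ in Set.Icc (t₀ - s) (t₀ + s), c := by
          rw [setLIntegral_const, Real.volume_Icc, add_sub_sub_cancel, two_mul]
      _ ≤ ∫⁻ t in Set.Icc (t₀ - s) (t₀ + s), F (x, g x + t) :=
          setLIntegral_mono' measurableSet_Icc fun t ht =>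
            h x hx t (abs_le.2 ⟨by linarith [ht.1], by linarith [ht.2]⟩)
      _ ≤ ∫⁻ t, F (x, g x + t) := setLIntegral_le_lintegral _ _
      _ = ∫⁻ t, F (x, t) := lintegral_add_left_eq_self (fun t => F (x, t)) (g x)
  calc _ = ∫⁻ _ in Set.Icc a b, c * ENNReal.ofReal (2 * s) := by
        rw [setLIntegral_const, Real.volume_Icc]
    _ ≤ ∫⁻ x in Set.Icc a b, ∫⁻ t, F (x, t) := setLIntegral_mono' measurableSet_Icc hline
    _ ≤ ∫⁻ x, ∫⁻ t, F (x, t) := setLIntegral_le_lintegral _ _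
    _ = ∫⁻ p, F p := by rw [Measure.volume_eq_prod, lintegral_prod _ hF.aemeasurable]

lemma measurable_setIntegral_smul_sub_mem {E : Type*} [NormedAddCommGroup E] [NormedSpace ℝ E]
    [MeasurableSpace E] [BorelSpace E] {K : Set (ℝ × ℝ)} (hK : MeasurableSet K) {w : ℝ × ℝ → E}
    (hw : StronglyMeasurable w) (R : ℝ) :
    Measurable fun x : ℝ × ℝ => ∫ y in {y | R⁻¹ • (x - y) ∈ K}, w y := by
  have hset : MeasurableSet {z : (ℝ × ℝ) × (ℝ × ℝ) | R⁻¹ • (z.1 - z.2) ∈ K} :=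
    ((measurable_fst.sub measurable_snd).const_smul R⁻¹) hK
  have hslice : ∀ x : ℝ × ℝ, MeasurableSet {y | R⁻¹ • (x - y) ∈ K} := fun x =>
    ((measurable_const.sub measurable_id).const_smul R⁻¹) hK
  simp only [← integral_indicator (hslice _)]
  exact (((hw.comp_measurable measurable_snd).indicator hset).integral_prod_right'
    (ν := volume)).measurable

theorem exists_lintegral_smoothed_ge {w : ℝ × ℝ → ℂ} (hw : Integrable w)
    (hwm : StronglyMeasurable w) {t₀ : ℝ} (ht₀ : ∫ y in {y : ℝ × ℝ | y.2 ≤ t₀}, w y ≠ 0) :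
    ∃ s > 0, ∀ (K : Set (ℝ × ℝ)) (a b δ : ℝ) (f : ℝ → ℝ), MeasurableSet K → a < b → 0 < δ →
      HasFlatGraph K s a b δ f → ∃ c > 0, ∀ᶠ R in atTop, ENNReal.ofReal (c * R) ≤
        ∫⁻ x : ℝ × ℝ, ‖∫ y in {y | R⁻¹ • (x - y) ∈ K}, w y‖ₑ ^ 2 := by
  set Φ := ∫ y in {y : ℝ × ℝ | y.2 ≤ t₀}, w y
  have hΦ : 0 < ‖Φ‖ := norm_pos_iff.2 ht₀
  obtain ⟨s, hs, herror⟩ := exists_setIntegral_flatError_le hw t₀ (half_pos hΦ)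
  refine ⟨s, hs, fun K a b δ f hK hab hδ hflat => ?_⟩
  refine ⟨(‖Φ‖ / 2) ^ 2 * (2 * s) * (b - a), mul_pos (by positivity) (sub_pos.2 hab), ?_⟩
  filter_upwards [eventually_gt_atTop 0, eventually_ge_atTop ((1 / s + |t₀| + s) / δ)] with R hR hRδ
  rw [div_le_iff₀' hδ] at hRδ
  have htube : ∀ x ∈ Set.Icc (R * a) (R * b), ∀ t, |t - t₀| ≤ s →
      ENNReal.ofReal ((‖Φ‖ / 2) ^ 2) ≤
        ‖∫ y in {y | R⁻¹ • ((x, R * f (x / R) + t) - y) ∈ K}, w y‖ₑ ^ 2 := by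
    intro x hx t ht
    have hxR : x / R ∈ Set.Icc a b := ⟨(le_div_iff₀' hR).2 hx.1, (div_le_iff₀' hR).2 hx.2⟩
    have hlower := le_norm_setIntegral_of_hasFlatGraph hw hK hflat hR hs hRδ hxR ht
    rw [mul_div_cancel₀ _ hR.ne'] at hlower
    rw [← ofReal_norm, ← ENNReal.ofReal_pow (norm_nonneg _)]
    gcongr
    linarith
  calc ENNReal.ofReal ((‖Φ‖ / 2) ^ 2 * (2 * s) * (b - a) * R)
      = ENNReal.ofReal ((‖Φ‖ / 2) ^ 2) * ENNReal.ofReal (2 * s) *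
          ENNReal.ofReal (R * b - R * a) := by
        rw [← ENNReal.ofReal_mul (by positivity), ← ENNReal.ofReal_mul (by positivity)]
        congr 1
        ring
    _ ≤ _ := lintegral_ge_of_le_on_tube
        ((measurable_setIntegral_smul_sub_mem hK hwm R).enorm.pow_const 2) htube

lemma ae_eq_zero_of_forall_setIntegral_Iic {E : Type*} [NormedAddCommGroup E] [NormedSpace ℝ E]
    [CompleteSpace E] {W : ℝ → E} (hW : Integrable W) (h : ∀ t, ∫ x in Set.Iic t, W x = 0) :
    ∀ᵐ x, W x = 0 := by
  filter_upwards [LocallyIntegrable.ae_hasDerivAt_integral hW.locallyIntegrable] with x hx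
  have hprimitive : (fun y => ∫ z in (0 : ℝ)..y, W z) = fun _ => 0 := by
    ext y
    rw [← intervalIntegral.integral_Iic_sub_Iic hW.integrableOn hW.integrableOn, h, h, sub_zero]
  have hderiv := hx 0
  rw [hprimitive] at hderiv
  exact hderiv.unique (hasDerivAt_const x 0)

theorem exists_halfPlane_integral_ne_zero {w : ℝ × ℝ → ℂ} (hw : Integrable w) {e : ℝ → ℂ}
    (hew : Integrable fun p : ℝ × ℝ => e p.2 * w p) (hne : ∫ p : ℝ × ℝ, e p.2 * w p ≠ 0) :
    ∃ t, ∫ p in {p : ℝ × ℝ | p.2 ≤ t}, w p ≠ 0 := by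
  by_contra! hall
  apply hne
  rw [Measure.volume_eq_prod] at hw hew ⊢
  have hline : ∀ᵐ t, ∫ x, w (x, t) = 0 :=
    ae_eq_zero_of_forall_setIntegral_Iic hw.integral_prod_right fun t => by
      have hset : {p : ℝ × ℝ | p.2 ≤ t} = Set.univ ×ˢ Set.Iic t := by ext; simp
      have hw' : IntegrableOn w (Set.univ ×ˢ Set.Iic t) (volume.prod volume) := hw.integrableOn
      rw [← hall t, hset, Measure.volume_eq_prod, ← Measure.prod_restrict, Measure.restrict_univ]
      rw [IntegrableOn, ← Measure.prod_restrict, Measure.restrict_univ] at hw'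
      rw [integral_prod_symm _ hw']
  rw [integral_prod_symm _ hew]
  refine integral_eq_zero_of_ae ?_
  filter_upwards [hline] with t ht
  rw [integral_const_mul, ht, mul_zero, Pi.zero_apply]

end HalfPlane

/-! ### The energy of the Fourier transform along a ray -/

lemma lintegral_plane_polar {f : Plane → ℝ≥0∞} (hf : Measurable f) :
    ∫⁻ x, f x =
      ∫⁻ φ : AngleCircle, ∫⁻ r in Set.Ioi (0 : ℝ), ENNReal.ofReal r * f (r • unitVec φ) := by
  have hcoords : ∀ p : ℝ × ℝ, axisCoords ((π / 2 : ℝ) : AngleCircle) p = !₂[p.1, p.2] :=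
    fun p => by rw [axisCoords_apply, sub_self, rotate_zero]
  have hmeas : Measurable fun p : ℝ × ℝ => ENNReal.ofReal p.1 •
      f (axisCoords ((π / 2 : ℝ) : AngleCircle) (polarCoord.symm p)) :=
    (ENNReal.measurable_ofReal.comp measurable_fst).smul
      (hf.comp ((axisCoords _).continuous.comp continuous_polarCoord_symm).measurable)
  rw [← (measurePreserving_axisCoords ((π / 2 : ℝ) : AngleCircle)).lintegral_comp_emb
      (measurableEmbedding_axisCoords _), ← lintegral_comp_polarCoord_symm, polarCoord_target,
    Measure.volume_eq_prod, ← Measure.prod_restrict, lintegral_prod_symm _ hmeas.aemeasurable,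
    restrict_Ioo_eq_restrict_Ioc, ← AddCircle.lintegral_preimage (2 * π) (-π),
    show -π + 2 * π = π by ring]
  refine lintegral_congr fun φ => lintegral_congr fun r => ?_
  rw [smul_eq_mul, hcoords]
  congr 2
  apply plane_ext <;> simp [polarCoord_symm_apply]

/-- The contribution of the direction `φ` to the quadratic mean of `F` over the dilations `δ ≤ 1`.
For `F` the Fourier transform of the indicator function of a body, the weight `δ ^ 4` is the squared
Jacobian of the dilation by `δ`. -/
noncomputable def radialEnergy (F : Plane → ℂ) (ρ : ℝ) (φ : AngleCircle) : ℝ :=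
  ∫ δ in (0 : ℝ)..1, δ ^ 4 * ‖F ((δ * ρ) • unitVec φ)‖ ^ 2

section RadialEnergy

open Filter Topology

variable {F : Plane → ℂ}

lemma radialEnergy_nonneg (F : Plane → ℂ) (ρ : ℝ) (φ : AngleCircle) : 0 ≤ radialEnergy F ρ φ :=
  intervalIntegral.integral_nonneg zero_le_one fun _ _ => by positivity

lemma continuous_radialEnergy (hF : Continuous F) (ρ : ℝ) : Continuous (radialEnergy F ρ) := by
  have hpolar : Continuous fun p : AngleCircle × ℝ => (p.2 * ρ) • unitVec p.1 :=
    (continuous_snd.mul_const ρ).smul (continuous_unitVec.comp continuous_fst)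
  exact intervalIntegral.continuous_parametric_intervalIntegral_of_continuous'
    ((continuous_snd.pow 4).mul ((hF.comp hpolar).norm.pow 2)) 0 1

lemma ofReal_radialEnergy (hF : Continuous F) (ρ : ℝ) (φ : AngleCircle) :
    ENNReal.ofReal (radialEnergy F ρ φ) = ∫⁻ δ in Set.Ioc (0 : ℝ) 1,
      ENNReal.ofReal (δ ^ 4 * ‖F ((δ * ρ) • unitVec φ)‖ ^ 2) := by
  rw [radialEnergy, intervalIntegral.integral_of_le zero_le_one,
    ofReal_integral_eq_lintegral_ofReal]
  · exact (Continuous.integrableOn_Icc (by fun_prop)).mono_set Set.Ioc_subset_Icc_self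
  · exact .of_forall fun δ => by positivity

theorem lintegral_radialEnergy_le (hF : Continuous F) (ρ : ℝ) :
    ∫⁻ φ, ENNReal.ofReal (radialEnergy F ρ φ) ≤
      ∫⁻ ξ in Metric.closedBall 0 1, ENNReal.ofReal (‖ξ‖ ^ 2 * ‖F (ρ • ξ)‖ ^ 2) := by
  have hball : MeasurableSet (Metric.closedBall (0 : Plane) 1) := measurableSet_closedBall
  rw [← lintegral_indicator hball, lintegral_plane_polar (.indicator (by fun_prop) hball)]
  refine lintegral_mono fun φ => ?_
  rw [ofReal_radialEnergy hF]
  refine (setLIntegral_mono' measurableSet_Ioc fun r hr => ?_).trans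
    (lintegral_mono_set Set.Ioc_subset_Ioi_self)
  have hnorm := norm_smul_unitVec hr.1.le φ
  rw [Set.indicator_of_mem (by rw [mem_closedBall_zero_iff, hnorm]; exact hr.2), hnorm, smul_smul,
    mul_comm ρ r, ← ENNReal.ofReal_mul hr.1.le, ← mul_assoc, ← pow_succ']
  refine ENNReal.ofReal_le_ofReal (mul_le_mul_of_nonneg_right ?_ (by positivity))
  exact pow_le_pow_of_le_one hr.1.le hr.2 (by norm_num)

lemma eventually_forall_smul_unitVec_mem {t : ℝ} (ht : 0 < t) {θ : AngleCircle}
    {U : Set (ℝ × AngleCircle)} (hU : U ∈ 𝓝 (t, θ)) :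
    ∀ᶠ x in 𝓝 (t • unitVec θ), ∀ r > 0, ∀ φ, r • unitVec φ = x → (r, φ) ∈ U := by
  set S : Set Plane := (fun p : ℝ × AngleCircle => p.1 • unitVec p.2) ''
    ((Set.Icc 0 (t + 1) ×ˢ Set.univ) \ interior U)
  have hS : IsCompact S := ((isCompact_Icc.prod isCompact_univ).diff isOpen_interior).image
    (continuous_fst.smul (continuous_unitVec.comp continuous_snd))
  have hnot : t • unitVec θ ∉ S := by
    rintro ⟨⟨r, φ⟩, ⟨⟨hr : r ∈ _, -⟩, hφ⟩, h : r • unitVec φ = t • unitVec θ⟩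
    obtain rfl : r = t := by
      rw [← norm_smul_unitVec hr.1 φ, ← norm_smul_unitVec ht.le θ, h]
    obtain rfl : φ = θ := unitVec_injective (smul_right_injective Plane ht.ne' h)
    exact hφ (mem_interior_iff_mem_nhds.2 hU)
  have hnorm : ∀ᶠ x in 𝓝 (t • unitVec θ), ‖x‖ < t + 1 :=
    continuous_norm.continuousAt.eventually_lt_const <|
      (norm_smul_unitVec ht.le θ).trans_lt (lt_add_one t)
  filter_upwards [hS.isClosed.isOpen_compl.mem_nhds hnot, hnorm]
  rintro _ hx hlt r hr φ rfl
  rw [norm_smul_unitVec hr.le] at hlt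
  by_contra hmem
  exact hx ⟨(r, φ), ⟨⟨⟨hr.le, hlt.le⟩, trivial⟩, fun h => hmem (interior_subset h)⟩, rfl⟩

lemma lintegral_ray_mul_le_radialEnergy (hF : Continuous F) {χ : Plane → ℂ}
    (hχ : ∀ ξ, ‖χ ξ‖ ≤ 1) {φ : AngleCircle}
    (hsupp : ∀ r > 0, χ (r • unitVec φ) ≠ 0 → r ∈ Set.Icc (1 / 4 : ℝ) 1) (R : ℝ) :
    ∫⁻ r in Set.Ioi (0 : ℝ),
        ENNReal.ofReal r * ‖F (R • r • unitVec φ) * χ (r • unitVec φ)‖ₑ ^ 2 ≤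
      64 * ENNReal.ofReal (radialEnergy F R φ) := by
  rw [ofReal_radialEnergy hF, ← lintegral_const_mul' _ _ (by norm_num),
    ← lintegral_indicator measurableSet_Ioc]
  refine (setLIntegral_mono' measurableSet_Ioi fun r (hr : 0 < r) => ?_).trans
    (setLIntegral_le_lintegral _ _)
  by_cases hχr : χ (r • unitVec φ) = 0
  · simp [hχr]
  obtain ⟨hr₁, hr₂⟩ := hsupp r hr hχr
  rw [Set.indicator_of_mem (show r ∈ Set.Ioc (0 : ℝ) 1 from ⟨hr, hr₂⟩), smul_smul, mul_comm R r,
    ← ofReal_norm, ← ENNReal.ofReal_pow (norm_nonneg _), ← ENNReal.ofReal_mul hr.le,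
    ← ENNReal.ofReal_ofNat 64, ← ENNReal.ofReal_mul (by norm_num)]
  refine ENNReal.ofReal_le_ofReal ?_
  have hcube : 1 ≤ 64 * r ^ 3 := by
    have : (1 / 4 : ℝ) ^ 3 ≤ r ^ 3 := by gcongr
    linarith
  have hle : ‖F ((r * R) • unitVec φ) * χ (r • unitVec φ)‖ ≤ ‖F ((r * R) • unitVec φ)‖ := by
    rw [norm_mul]
    exact mul_le_of_le_one_right (norm_nonneg _) (hχ _)
  calc r * ‖F ((r * R) • unitVec φ) * χ (r • unitVec φ)‖ ^ 2
      ≤ r * ‖F ((r * R) • unitVec φ)‖ ^ 2 := by gcongr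
    _ ≤ r * ‖F ((r * R) • unitVec φ)‖ ^ 2 * (64 * r ^ 3) :=
        le_mul_of_one_le_right (by positivity) hcube
    _ = 64 * (r ^ 4 * ‖F ((r * R) • unitVec φ)‖ ^ 2) := by ring

theorem lintegral_mul_le_radialEnergy (hF : Continuous F) {χ : Plane → ℂ} (hχc : Continuous χ)
    (hχ : ∀ ξ, ‖χ ξ‖ ≤ 1) {S : Set AngleCircle} (hS : MeasurableSet S)
    (hsupp : ∀ r > 0, ∀ φ, χ (r • unitVec φ) ≠ 0 → (r, φ) ∈ Set.Icc (1 / 4 : ℝ) 1 ×ˢ S) (R : ℝ) :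
    ∫⁻ ξ, ‖F (R • ξ) * χ ξ‖ₑ ^ 2 ≤ 64 * ∫⁻ φ in S, ENNReal.ofReal (radialEnergy F R φ) := by
  rw [lintegral_plane_polar (by fun_prop), ← lintegral_const_mul' 64 _ (by norm_num),
    ← lintegral_indicator hS]
  refine lintegral_mono fun φ => ?_
  by_cases hφ : φ ∈ S
  · rw [Set.indicator_of_mem hφ]
    exact lintegral_ray_mul_le_radialEnergy hF hχ (fun r hr h => (hsupp r hr φ h).1) R
  · have hzero : ∀ r > (0 : ℝ), χ (r • unitVec φ) = 0 := fun r hr => by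
      by_contra h
      exact hφ (hsupp r hr φ h).2
    rw [Set.indicator_of_notMem hφ, nonpos_iff_eq_zero]
    refine setLIntegral_eq_zero measurableSet_Ioi fun r hr => ?_
    simp [hzero r hr]

end RadialEnergy

/-! ### The Fourier transform of the indicator function of a plane set -/

section FourierIndicator

variable {K : Set Plane}

lemma fourierIndicator_closure (hK : Convex ℝ K) :
    fourierIndicator (closure K) = fourierIndicator K := by
  ext ξ
  exact Real.fourier_congr_ae (indicator_ae_eq_of_ae_eq_set
    (closure_ae_eq_of_null_frontier (hK.addHaar_frontier volume))) ξ

lemma fourierIndicator_dilateRotate (K : Set Plane) {δ : ℝ} (hδ : δ ≠ 0) (θ ω : AngleCircle)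
    (ρ : ℝ) : fourierIndicator (dilateRotate δ θ K) (ρ • unitVec ω) =
      δ ^ 2 • fourierIndicator K ((δ * ρ) • unitVec (ω - θ)) := by
  have himage : dilateRotate δ θ K = (fun x => δ • x) '' (rotateIso θ '' K) :=
    (Set.image_image _ _ K).symm
  have hrotate : (rotateIso θ).symm (unitVec ω) = unitVec (ω - θ) := by
    rw [LinearIsometryEquiv.symm_apply_eq]
    exact ((rotate_unitVec θ (ω - θ)).trans (by rw [add_sub_cancel])).symm
  rw [fourierIndicator, himage, fourier_indicator_smul _ _ hδ,
    fourier_indicator_image_linearIsometryEquiv, finrank_euclideanSpace_fin, abs_sq, smul_smul,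
    map_smul, hrotate]
  rfl

lemma norm_fourierIndicator_neg (K : Set Plane) (ξ : Plane) :
    ‖fourierIndicator K (-ξ)‖ = ‖fourierIndicator K ξ‖ := by
  have hreal : (K.indicator fun _ => (1 : ℂ)) =
      fun x => ((K.indicator (fun _ => 1) x : ℝ) : ℂ) := by
    ext x
    by_cases hx : x ∈ K <;> simp [hx]
  rw [fourierIndicator, fourierIndicator, hreal, fourier_ofReal_neg, RCLike.norm_conj]

lemma radialEnergy_fourierIndicator_add_pi (K : Set Plane) (ρ : ℝ) (φ : AngleCircle) :
    radialEnergy (fourierIndicator K) ρ (φ + ((π : ℝ) : AngleCircle)) =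
      radialEnergy (fourierIndicator K) ρ φ := by
  simp only [radialEnergy, unitVec_add_pi, smul_neg, norm_fourierIndicator_neg]

lemma fourierAverage_eq (K : Set Plane) (I : Set AngleCircle) (ω : AngleCircle) (ρ : ℝ) :
    fourierAverage K I ω ρ = ∫ θ in I, radialEnergy (fourierIndicator K) ρ (ω - θ) := by
  refine integral_congr_ae (.of_forall fun θ => intervalIntegral.integral_congr_ae ?_)
  refine .of_forall fun δ hδ => ?_
  rw [Set.uIoc_of_le zero_le_one] at hδ
  rw [fourierIndicator_dilateRotate K hδ.1.ne', norm_smul, norm_pow, Real.norm_eq_abs, sq_abs,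
    mul_pow, ← pow_mul]

lemma IsPlanarConvexBody.continuous_fourierIndicator {C : Set Plane} (hC : IsPlanarConvexBody C) :
    Continuous (fourierIndicator C) :=
  continuous_fourier (integrable_indicator_one hC.convex hC.bounded)

lemma ofReal_fourierAverage {C : Set Plane} (hC : IsPlanarConvexBody C) (I : Set AngleCircle)
    (ω : AngleCircle) (ρ : ℝ) :
    ENNReal.ofReal (fourierAverage C I ω ρ) =
      ∫⁻ θ in I, ENNReal.ofReal (radialEnergy (fourierIndicator C) ρ (ω - θ)) := by
  have hcont : Continuous fun θ => radialEnergy (fourierIndicator C) ρ (ω - θ) :=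
    (continuous_radialEnergy hC.continuous_fourierIndicator ρ).comp (continuous_sub_left ω)
  rw [fourierAverage_eq, ofReal_integral_eq_lintegral_ofReal]
  · exact (hcont.continuousOn.integrableOn_compact isCompact_univ).mono_set (Set.subset_univ I)
  · exact .of_forall fun θ => radialEnergy_nonneg _ _ _

end FourierIndicator

section LowerBound

open Filter Topology

open scoped SchwartzMap

lemma exists_schwartz_bump {V : Type*} [NormedAddCommGroup V] [NormedSpace ℝ V]
    [FiniteDimensional ℝ V] {x : V} {U : Set V} (hU : U ∈ 𝓝 x) :
    ∃ χ : 𝓢(V, ℂ), χ x = 1 ∧ (∀ ξ, ‖χ ξ‖ ≤ 1) ∧ ∀ ξ, χ ξ ≠ 0 → ξ ∈ U := by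
  obtain ⟨f, hsupp, hcomp, hsmooth, hrange, hone⟩ := exists_contDiff_tsupport_subset (n := ⊤) hU
  have hcomp' : HasCompactSupport fun ξ => (f ξ : ℂ) := hcomp.comp_left (g := Complex.ofReal) rfl
  refine ⟨hcomp'.toSchwartzMap (Complex.ofRealCLM.contDiff.comp hsmooth), ?_, fun ξ => ?_,
    fun ξ hξ => ?_⟩
  · exact congrArg Complex.ofReal hone
  · obtain ⟨h₀, h₁⟩ := hrange (Set.mem_range_self ξ)
    exact (Complex.norm_of_nonneg h₀).trans_le h₁
  · exact hsupp (subset_tsupport f fun h => hξ (congrArg Complex.ofReal h))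

lemma exists_halfPlane_integral_axisCoords_ne_zero {v : Plane → ℂ} (hv : Integrable v)
    {θ : AngleCircle} {τ : ℝ} (h : 𝓕 v (τ • unitVec θ) ≠ 0) :
    ∃ t, ∫ p in {p : ℝ × ℝ | p.2 ≤ t}, v (axisCoords θ p) ≠ 0 := by
  have hmp := measurePreserving_axisCoords θ
  have hinner : ∀ p, inner ℝ (axisCoords θ p) (τ • unitVec θ) = τ * p.2 := fun p => by
    have := inner_axisCoords θ 0 p
    rw [AddCircle.coe_zero, add_zero, Real.cos_zero, Real.sin_zero, mul_one, mul_zero,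
      sub_zero] at this
    rw [real_inner_smul_right, this]
  have hv' : Integrable fun p => v (axisCoords θ p) :=
    (hmp.integrable_comp_emb (measurableEmbedding_axisCoords θ)).2 hv
  refine exists_halfPlane_integral_ne_zero (e := fun t => (𝐞 (-(τ * t)) : ℂ)) hv' ?_ ?_
  · have := (hmp.integrable_comp_emb (measurableEmbedding_axisCoords θ)).2
      ((Real.fourierIntegral_convergent_iff (τ • unitVec θ)).2 hv)
    simpa only [Function.comp_def, hinner, Circle.smul_def, smul_eq_mul] using this
  · rw [Real.fourier_eq, ← hmp.integral_comp (measurableEmbedding_axisCoords θ)] at h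
    simpa only [hinner, Circle.smul_def, smul_eq_mul] using h

lemma lintegral_enorm_sq_fourier_indicator_mul_schwartz {V : Type*} [NormedAddCommGroup V]
    [InnerProductSpace ℝ V] [FiniteDimensional ℝ V] [MeasurableSpace V] [BorelSpace V] {K : Set V}
    (hKm : MeasurableSet K) (hK : Integrable (K.indicator fun _ => (1 : ℂ))) (χ : 𝓢(V, ℂ))
    {R : ℝ} (hR : R ≠ 0) :
    ENNReal.ofReal |R ^ Module.finrank ℝ V| ^ 2 *
        ∫⁻ ξ, ‖𝓕 (K.indicator fun _ => (1 : ℂ)) (R • ξ) * χ ξ‖ₑ ^ 2 =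
      ∫⁻ x, ‖∫ y in {y | R⁻¹ • (x - y) ∈ K}, (𝓕⁻ χ : 𝓢(V, ℂ)) y‖ₑ ^ 2 := by
  have hscale : ∀ ξ, ‖𝓕 (fun x => K.indicator (fun _ => (1 : ℂ)) (R⁻¹ • x)) ξ * χ ξ‖ₑ ^ 2 =
      ENNReal.ofReal |R ^ Module.finrank ℝ V| ^ 2 *
        ‖𝓕 (K.indicator fun _ => (1 : ℂ)) (R • ξ) * χ ξ‖ₑ ^ 2 := fun ξ => by
    rw [fourier_comp_inv_smul _ hR, smul_mul_assoc, enorm_smul, mul_pow, Real.enorm_abs,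
      Real.enorm_eq_ofReal_abs]
  rw [← lintegral_const_mul' _ _ (by finiteness), ← lintegral_congr hscale,
    lintegral_enorm_sq_fourier_mul_schwartz (hK.comp_smul (inv_ne_zero hR))]
  refine lintegral_congr fun x => ?_
  have hset : MeasurableSet {y | R⁻¹ • (x - y) ∈ K} :=
    ((measurable_const.sub measurable_id).const_smul R⁻¹) hKm
  rw [← integral_indicator hset]
  congr 3 with y
  by_cases hy : R⁻¹ • (x - y) ∈ K <;> simp [hy]

lemma lintegral_enorm_sq_fourierIndicator_mul_schwartz {K : Set Plane} (hKm : MeasurableSet K)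
    (hK : Integrable (K.indicator fun _ => (1 : ℂ))) (χ : 𝓢(Plane, ℂ)) (θ : AngleCircle) {R : ℝ}
    (hR : R ≠ 0) :
    ENNReal.ofReal (R ^ 4) * ∫⁻ ξ, ‖fourierIndicator K (R • ξ) * χ ξ‖ₑ ^ 2 =
      ∫⁻ p : ℝ × ℝ, ‖∫ q in {q | R⁻¹ • (p - q) ∈ axisCoords θ ⁻¹' K},
        (𝓕⁻ χ : 𝓢(Plane, ℂ)) (axisCoords θ q)‖ₑ ^ 2 := by
  have hmp := measurePreserving_axisCoords θ
  have hemb := measurableEmbedding_axisCoords θ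
  have hpow : ENNReal.ofReal (R ^ 4) = ENNReal.ofReal |R ^ Module.finrank ℝ Plane| ^ 2 := by
    rw [← ENNReal.ofReal_pow (abs_nonneg _), finrank_euclideanSpace_fin, sq_abs, ← pow_mul]
  rw [hpow]
  refine (lintegral_enorm_sq_fourier_indicator_mul_schwartz hKm hK χ hR).trans ?_
  rw [← hmp.lintegral_comp_emb hemb]
  refine lintegral_congr fun p => ?_
  rw [← hmp.setIntegral_preimage_emb hemb]
  simp only [Set.preimage_ofPred_eq, Set.mem_preimage, map_smul, map_sub]

lemma lintegral_smoothed_le_radialEnergy {C : Set Plane} (hC : IsPlanarConvexBody C)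
    {χ : 𝓢(Plane, ℂ)} (hχ : ∀ ξ, ‖χ ξ‖ ≤ 1) {S : Set AngleCircle} (hS : MeasurableSet S)
    (hsupp : ∀ r > 0, ∀ φ, χ (r • unitVec φ) ≠ 0 → (r, φ) ∈ Set.Icc (1 / 4 : ℝ) 1 ×ˢ S)
    (θ : AngleCircle) {R : ℝ} (hR : R ≠ 0) :
    ∫⁻ p : ℝ × ℝ, ‖∫ q in {q | R⁻¹ • (p - q) ∈ axisCoords θ ⁻¹' closure C},
        (𝓕⁻ χ : 𝓢(Plane, ℂ)) (axisCoords θ q)‖ₑ ^ 2 ≤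
      ENNReal.ofReal (R ^ 4) *
        (64 * ∫⁻ φ in S, ENNReal.ofReal (radialEnergy (fourierIndicator C) R φ)) := by
  rw [← lintegral_enorm_sq_fourierIndicator_mul_schwartz isClosed_closure.measurableSet
    (integrable_indicator_one hC.convex.closure hC.bounded.closure) χ θ hR,
    fourierIndicator_closure hC.convex]
  gcongr
  exact lintegral_mul_le_radialEnergy hC.continuous_fourierIndicator χ.continuous hχ hS hsupp R

theorem exists_lintegral_radialEnergy_ge {C : Set Plane} (hC : IsPlanarConvexBody C)
    {θ : AngleCircle} (hθ : θ ∉ angularTrace C) {S : Set AngleCircle} (hSm : MeasurableSet S)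
    (hS : S ∈ 𝓝 θ) :
    ∃ c > 0, ∀ᶠ R in atTop, ENNReal.ofReal (c * R ^ (-3 : ℤ)) ≤
      ∫⁻ φ in S, ENNReal.ofReal (radialEnergy (fourierIndicator C) R φ) := by
  obtain ⟨χ, hχ, hχ₁, hsupp⟩ := exists_schwartz_bump <|
    eventually_forall_smul_unitVec_mem (one_half_pos (α := ℝ))
      (prod_mem_nhds (Icc_mem_nhds (by norm_num : (1 / 4 : ℝ) < 1 / 2) one_half_lt_one) hS)
  set v : 𝓢(Plane, ℂ) := 𝓕⁻ χ
  have hv : 𝓕 (v : Plane → ℂ) ((1 / 2 : ℝ) • unitVec θ) ≠ 0 := by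
    rw [← SchwartzMap.fourier_coe, FourierTransform.fourier_fourierInv_eq, hχ]
    exact one_ne_zero
  obtain ⟨t₀, ht₀⟩ := exists_halfPlane_integral_axisCoords_ne_zero v.integrable hv
  have hv' : Integrable fun p => v (axisCoords θ p) :=
    ((measurePreserving_axisCoords θ).integrable_comp_emb (measurableEmbedding_axisCoords θ)).2
      v.integrable
  obtain ⟨s, hs, hflatBound⟩ := exists_lintegral_smoothed_ge hv'
    (v.continuous.comp (axisCoords θ).continuous).stronglyMeasurable ht₀
  obtain ⟨a, b, r, f, hab, hr, hflat⟩ := exists_hasFlatGraph_of_notMem_angularTrace hC hθ hs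
  obtain ⟨c, hc, hev⟩ := hflatBound _ a b r f
    ((axisCoords θ).continuous.measurable isClosed_closure.measurableSet) hab hr hflat
  refine ⟨c / 64, by positivity, ?_⟩
  filter_upwards [hev, eventually_gt_atTop 0] with R hR hR₀
  have hmain := hR.trans <| lintegral_smoothed_le_radialEnergy hC hχ₁ hSm
    (fun r hr φ h => hsupp _ h r hr φ rfl) θ hR₀.ne'
  rw [← mul_assoc, ← ENNReal.ofReal_ofNat 64, ← ENNReal.ofReal_mul (by positivity)] at hmain
  calc ENNReal.ofReal (c / 64 * R ^ (-3 : ℤ))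
      = ENNReal.ofReal (c * R) / ENNReal.ofReal (R ^ 4 * 64) := by
        rw [← ENNReal.ofReal_div_of_pos (by positivity), zpow_neg]
        congr 1
        field_simp
    _ ≤ _ := ENNReal.div_le_of_le_mul' hmain

end LowerBound

/-! ### Lower bounds over arcs -/

section Arcs

open Filter Metric Topology

section AddCircle

variable {p : ℝ}

lemma closedBall_coe_eq_image (m r : ℝ) :
    closedBall (m : AddCircle p) r = (↑) '' closedBall m r := by
  refine Set.Subset.antisymm (fun φ hφ => ?_) ?_
  · obtain ⟨t, rfl⟩ := QuotientAddGroup.mk_surjective φ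
    have ht : t ∈ ((↑) : ℝ → AddCircle p) ⁻¹' closedBall (m : AddCircle p) r := hφ
    rw [AddCircle.coe_real_preimage_closedBall_eq_iUnion] at ht
    obtain ⟨n, hn⟩ := Set.mem_iUnion.1 ht
    refine ⟨t - n • p, ?_, by simp [AddCircle.coe_period]⟩
    rw [mem_closedBall, Real.dist_eq] at hn ⊢
    convert hn using 2
    ring
  · rw [Set.image_subset_iff, AddCircle.coe_real_preimage_closedBall_eq_iUnion]
    exact fun t ht => Set.mem_iUnion.2 ⟨0, by simpa using ht⟩

lemma isPreconnected_closedBall_addCircle (φ : AddCircle p) (r : ℝ) :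
    IsPreconnected (closedBall φ r) := by
  obtain ⟨m, rfl⟩ := QuotientAddGroup.mk_surjective φ
  change IsPreconnected (closedBall (m : AddCircle p) r)
  rw [closedBall_coe_eq_image]
  exact (convex_closedBall m r).isPreconnected.image _ (AddCircle.continuous_mk' p).continuousOn

variable [Fact (0 < p)]

lemma volume_image_coe_le_ediam (J : Set ℝ) :
    volume (((↑) : ℝ → AddCircle p) '' J) ≤ ediam J := by
  by_cases hJ : Bornology.IsBounded J
  · have hsub : J ⊆ closedBall ((sInf J + sSup J) / 2) ((sSup J - sInf J) / 2) := by
      rw [← Real.Icc_eq_closedBall]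
      exact subset_Icc_csInf_csSup hJ.bddBelow hJ.bddAbove
    calc volume (((↑) : ℝ → AddCircle p) '' J)
        ≤ volume (closedBall (((sInf J + sSup J) / 2 : ℝ) : AddCircle p)
            ((sSup J - sInf J) / 2)) := by
          rw [closedBall_coe_eq_image]
          exact measure_mono (Set.image_mono hsub)
      _ ≤ ediam J := by
          rw [AddCircle.volume_closedBall, Real.ediam_eq hJ, mul_div_cancel₀ _ two_ne_zero]
          exact ENNReal.ofReal_le_ofReal (min_le_right _ _)
  · rw [ediam_eq_top_iff_unbounded.2 hJ]
    exact le_top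

lemma exists_closedBall_subset_image_coe {J : Set ℝ} (hJ : J.OrdConnected) {ψ : ℝ≥0∞}
    (hψ : ψ < volume (((↑) : ℝ → AddCircle p) '' J)) :
    ∃ m r : ℝ, ψ < ENNReal.ofReal (min p (2 * r)) ∧
      closedBall (m : AddCircle p) r ⊆ (↑) '' J := by
  have hp : ψ < ENNReal.ofReal p :=
    hψ.trans_le ((measure_mono (Set.subset_univ _)).trans_eq (AddCircle.measure_univ p))
  obtain ⟨x, hx, y, hy, hxy⟩ : ∃ x ∈ J, ∃ y ∈ J, ψ < edist x y := by
    by_contra! h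
    exact hψ.not_ge ((volume_image_coe_le_ediam J).trans (ediam_le h))
  wlog hle : x ≤ y generalizing x y
  · exact this y hy x hx (edist_comm x y ▸ hxy) (le_of_not_ge hle)
  refine ⟨(x + y) / 2, (y - x) / 2, ?_, ?_⟩
  · rw [edist_comm, edist_dist, Real.dist_eq, abs_of_nonneg (sub_nonneg.2 hle)] at hxy
    rw [mul_div_cancel₀ _ two_ne_zero, ENNReal.ofReal_min]
    exact lt_min hp hxy
  · rw [closedBall_coe_eq_image, ← Real.Icc_eq_closedBall]
    exact Set.image_mono (hJ.out hx hy)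

end AddCircle

variable {C : Set Plane}

lemma isOpen_symmetricTrace (C : Set Plane) : IsOpen (symmetricTrace C) := by
  have h : IsOpen (angularTrace C) := isOpen_biUnion fun _ _ => isOpen_interior
  exact h.inter (isOpenMap_add_right _ _ h)

lemma exists_notMem_symmetricTrace {φ : AngleCircle} {r : ℝ}
    (h : symmetricAngularThreshold C < volume (closedBall φ r)) :
    ∃ z ∈ closedBall φ r, z ∉ symmetricTrace C := by
  by_contra! hall
  have hφ : φ ∈ closedBall φ r := by
    obtain ⟨x, hx⟩ := nonempty_of_measure_ne_zero h.ne_bot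
    exact mem_closedBall_self (nonempty_closedBall.1 ⟨x, hx⟩)
  refine h.not_ge ((measure_mono ?_).trans (le_iSup₂ (f := fun θ _ =>
    volume (connectedComponentIn (symmetricTrace C) θ)) φ (hall φ hφ)))
  exact (isPreconnected_closedBall_addCircle φ r).subset_connectedComponentIn hφ hall

lemma notMem_angularTrace_or_of_notMem_symmetricTrace {z : AngleCircle}
    (hz : z ∉ symmetricTrace C) :
    z ∉ angularTrace C ∨ z - ((π : ℝ) : AngleCircle) ∉ angularTrace C := by
  by_contra! h
  exact hz ⟨h.1, _, h.2, sub_add_cancel _ _⟩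

lemma exists_lintegral_radialEnergy_ge_of_notMem_symmetricTrace (hC : IsPlanarConvexBody C)
    {z : AngleCircle} (hz : z ∉ symmetricTrace C) {η : ℝ} (hη : 0 < η) :
    ∃ c > 0, ∀ᶠ R in atTop, ENNReal.ofReal (c * R ^ (-3 : ℤ)) ≤
      ∫⁻ φ in ball z η, ENNReal.ofReal (radialEnergy (fourierIndicator C) R φ) := by
  rcases notMem_angularTrace_or_of_notMem_symmetricTrace hz with h | h
  · exact exists_lintegral_radialEnergy_ge hC h measurableSet_ball (ball_mem_nhds _ hη)
  · have hmp := measurePreserving_add_right (volume : Measure AngleCircle) ((π : ℝ) : AngleCircle)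
    have hshift : ∀ R, ∫⁻ φ in ball z η, ENNReal.ofReal (radialEnergy (fourierIndicator C) R φ) =
        ∫⁻ φ in ball (z - ((π : ℝ) : AngleCircle)) η,
          ENNReal.ofReal (radialEnergy (fourierIndicator C) R φ) := fun R => by
      rw [← hmp.setLIntegral_comp_preimage_emb (measurableEmbedding_addRight _) _ (ball z η),
        preimage_add_right_ball]
      simp only [radialEnergy_fourierIndicator_add_pi]
    simp only [hshift]
    exact exists_lintegral_radialEnergy_ge hC h measurableSet_ball (ball_mem_nhds _ hη)

lemma exists_forall_finite_ofReal_mul_zpow_le {ι : Type*} {t : Set ι} (ht : t.Finite)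
    {g : ι → ℝ → ℝ≥0∞} {k : ℤ}
    (h : ∀ i ∈ t, ∃ c > 0, ∀ᶠ R in atTop, ENNReal.ofReal (c * R ^ k) ≤ g i R) :
    ∃ c > 0, ∀ᶠ R in atTop, ∀ i ∈ t, ENNReal.ofReal (c * R ^ k) ≤ g i R := by
  have hsmall : ∀ i ∈ t, ∀ᶠ c in 𝓝[>] (0 : ℝ), ∀ᶠ R in atTop,
      ENNReal.ofReal (c * R ^ k) ≤ g i R := fun i hi => by
    obtain ⟨c, hc, hev⟩ := h i hi
    filter_upwards [Ioc_mem_nhdsGT hc] with c' hc'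
    filter_upwards [hev, eventually_gt_atTop 0] with R hR hR₀
    refine le_trans ?_ hR
    gcongr
    exact hc'.2
  obtain ⟨c, hev, hc⟩ := (((eventually_all_finite ht).2 hsmall).and self_mem_nhdsWithin).exists
  exact ⟨c, hc, (eventually_all_finite ht).2 hev⟩

theorem exists_lintegral_radialEnergy_closedBall_ge (hC : IsPlanarConvexBody C) {r : ℝ}
    (hr : symmetricAngularThreshold C < ENNReal.ofReal (min (2 * π) (2 * r))) :
    ∃ c > 0, ∀ᶠ R in atTop, ∀ φ₀ : AngleCircle, ENNReal.ofReal (c * R ^ (-3 : ℤ)) ≤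
      ∫⁻ φ in closedBall φ₀ r, ENNReal.ofReal (radialEnergy (fourierIndicator C) R φ) := by
  have hcont : Continuous fun s : ℝ => ENNReal.ofReal (min (2 * π) (2 * s)) :=
    ENNReal.continuous_ofReal.comp (by fun_prop)
  obtain ⟨r', hr', hr'r⟩ : ∃ r', symmetricAngularThreshold C <
      ENNReal.ofReal (min (2 * π) (2 * r')) ∧ r' < r :=
    (((hcont.tendsto r).eventually (lt_mem_nhds hr)).filter_mono nhdsWithin_le_nhds |>.and
      (self_mem_nhdsWithin (s := Set.Iio r))).exists
  obtain ⟨t, htrace, htfin, hcover⟩ :=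
    (isOpen_symmetricTrace C).isClosed_compl.isCompact.finite_cover_balls
      (half_pos (sub_pos.2 hr'r))
  obtain ⟨c, hc, hev⟩ := exists_forall_finite_ofReal_mul_zpow_le htfin fun z hz =>
    exists_lintegral_radialEnergy_ge_of_notMem_symmetricTrace hC (htrace hz)
      (half_pos (sub_pos.2 hr'r))
  refine ⟨c, hc, hev.mono fun R hR φ₀ => ?_⟩
  obtain ⟨z, hzφ₀, hz⟩ := exists_notMem_symmetricTrace (φ := φ₀) (r := r')
    (hr'.trans_eq (AddCircle.volume_closedBall _ r').symm)
  obtain ⟨x, hxt, hzx⟩ := Set.mem_iUnion₂.1 (hcover hz)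
  refine (hR x hxt).trans (lintegral_mono_set (ball_subset_closedBall.trans ?_))
  refine closedBall_subset_closedBall' ?_
  rw [mem_ball'] at hzx
  rw [mem_closedBall] at hzφ₀
  linarith [dist_triangle x z φ₀]

theorem exists_le_fourierAverage (hC : IsPlanarConvexBody C) {I : Set AngleCircle}
    (hI : IsAngleInterval I) (hlow : symmetricAngularThreshold C < volume I) :
    ∃ c > 0, ∀ᶠ ρ in atTop, ∀ ω, c * ρ ^ (-3 : ℤ) ≤ fourierAverage C I ω ρ := by
  obtain ⟨J, hJ, rfl⟩ := hI
  obtain ⟨m, r, hr, hsub⟩ := exists_closedBall_subset_image_coe hJ hlow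
  obtain ⟨c, hc, hev⟩ := exists_lintegral_radialEnergy_closedBall_ge hC hr
  refine ⟨c, hc, hev.mono fun ρ hρ ω => ?_⟩
  have hnonneg : 0 ≤ fourierAverage C ((↑) '' J) ω ρ := by
    rw [fourierAverage_eq]
    exact integral_nonneg fun θ => radialEnergy_nonneg _ _ _
  have hpre : (fun θ => ω - θ) ⁻¹' closedBall (ω - (m : AngleCircle)) r ⊆ (↑) '' J :=
    fun θ hθ => hsub (by simpa only [Set.mem_preimage, mem_closedBall, dist_sub_left] using hθ)
  rw [← ENNReal.ofReal_le_ofReal_iff hnonneg, ofReal_fourierAverage hC]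
  refine (hρ (ω - m)).trans (le_trans (le_of_eq ?_) (lintegral_mono_set hpre))
  exact ((Measure.measurePreserving_sub_left volume ω).setLIntegral_comp_preimage
    measurableSet_closedBall
      (continuous_radialEnergy hC.continuous_fourierIndicator ρ).measurable.ennreal_ofReal).symm

theorem fourierAverage_le (hC : IsPlanarConvexBody C) {B : ℝ} (hB : ∀ x ∈ C, ‖x‖ ≤ B)
    (I : Set AngleCircle) (ω : AngleCircle) {ρ : ℝ} (hρ : 0 < ρ) :
    fourierAverage C I ω ρ ≤ 4 * B * ρ ^ (-3 : ℤ) := by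
  obtain ⟨x, hx⟩ := hC.nonempty_interior
  have hB₀ : 0 ≤ B := (norm_nonneg x).trans (hB x (interior_subset hx))
  have hcont := hC.continuous_fourierIndicator
  rw [← ENNReal.ofReal_le_ofReal_iff (by positivity), ofReal_fourierAverage hC]
  calc ∫⁻ θ in I, ENNReal.ofReal (radialEnergy (fourierIndicator C) ρ (ω - θ))
      ≤ ∫⁻ θ, ENNReal.ofReal (radialEnergy (fourierIndicator C) ρ (ω - θ)) :=
        setLIntegral_le_lintegral _ _
    _ = ∫⁻ φ, ENNReal.ofReal (radialEnergy (fourierIndicator C) ρ φ) :=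
        (Measure.measurePreserving_sub_left volume ω).lintegral_comp
          (continuous_radialEnergy hcont ρ).measurable.ennreal_ofReal
    _ ≤ _ := lintegral_radialEnergy_le hcont ρ
    _ ≤ _ := lintegral_norm_mul_fourier_indicator_le hC.convex hB hρ
    _ = ENNReal.ofReal (4 * B * ρ ^ (-3 : ℤ)) := by
        rw [pow_one, ← ENNReal.ofReal_mul (by positivity), Nat.cast_one, one_add_one_eq_two,
          ← ENNReal.ofReal_ofNat 2, ← ENNReal.ofReal_mul zero_le_two, zpow_neg]
        congr 1
        norm_cast
        ring

end Arcs

theorem lemma3p5 (C : Set Plane) (hC : IsPlanarConvexBody C)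
    (I : Set AngleCircle) (hI : IsAngleInterval I)
    (hlow : symmetricAngularThreshold C < volume I)
    (hup : volume I ≤ ENNReal.ofReal (2 * π)) :
    ∃ c₁ c₂ ρ₀ : ℝ, 0 < c₁ ∧ 0 < c₂ ∧ 0 < ρ₀ ∧
      ∀ ω : AngleCircle, ∀ ρ : ℝ, ρ₀ ≤ ρ →
        c₁ * ρ ^ (-3 : ℤ) ≤ fourierAverage C I ω ρ ∧
          fourierAverage C I ω ρ ≤ c₂ * ρ ^ (-3 : ℤ) := by
  obtain ⟨c₁, hc₁, hlower⟩ := exists_le_fourierAverage hC hI hlow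
  obtain ⟨B, hB₀, hB⟩ := hC.bounded.exists_pos_norm_le
  obtain ⟨ρ₀, hρ₀⟩ :=
    Filter.eventually_atTop.1 (hlower.and (Filter.eventually_gt_atTop (0 : ℝ)))
  refine ⟨c₁, 4 * B, ρ₀, hc₁, by positivity, (hρ₀ ρ₀ le_rfl).2, fun ω ρ hρ => ?_⟩
  exact ⟨(hρ₀ ρ hρ).1 ω, fourierAverage_le hC hB I ω (hρ₀ ρ hρ).2⟩
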